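/- Let $n\ge 2$, let $M$ and $N$ be smooth (Hausdorff, second countable) manifolds without boundary, of dimensions $n$ and $n-2$, with volume forms (nowhere vanishing smooth forms of top degree) $\mu$ on $M$ and $\Omega$ on $N$. Let $f\colon M\to N$ be a smooth map and let $k\in C^\infty(M)$ vanish nowhere. Then $$\{g,h\}\,\mu = k\,dg\wedge dh\wedge f^*\Omega,\qquad g,h\in C^\infty(M),$$ defines a unique operation $\{\cdot,\cdot\}$ on $C^\infty(M)$, and it is a Poisson bracket, i.e. a Lie bracket that is a derivation in each factor. The symplectic leaf through $q\in M$ is the set of points that can be joined with $q$ by a piecewise smooth curve each of whose pieces is a trajectory of a locally defined Hamiltonian vector field $X_h=\{\cdot,h\}$. Let $C\subset M$ be the set of critical points of $f$ (the points where $df$ is not surjective), call the points of $f(C)$ the singular values of $f$, and those of $N\setminus f(C)$ its regular values. Every symplectic leaf is an embedded submanifold of $M$, tangent to the characteristic distribution $\{X_h(q) : h\in C^\infty(M)\}$, of dimension $2$ or $0$. The leaves are precisely the following sets: (i) the connected components of $f^{-1}(s)$, for $s\in N$ a regular value of $f$; they are $2$-dimensional; (ii) the connected components of $f^{-1}(s)\setminus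 C$, for $s\in N$ a singular value of $f$; they are $2$-dimensional; (iii) the single points of $C$; they are $0$-dimensional. -/

import Mathlib

open scoped Manifold ContDiff

noncomputable section

/-! ### Differential forms -/

/-- The wedge product `α ∧ η` of a covector with an alternating `p`-form, normalised so that
`(α ∧ η)(v₀, …, v_p) = ∑ i, (-1)^i α(v_i) η(v₀, …, v̂_i, …, v_p)`. -/
def covectorWedge {V : Type*} [AddCommGroup V] [Module ℝ V] {p : ℕ}
    (α : V →ₗ[ℝ] ℝ) (η : V [⋀^Fin p]→ₗ[ℝ] ℝ) : V [⋀^Fin (p + 1)]→ₗ[ℝ] ℝ :=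
  AlternatingMap.alternatizeUncurryFin (α.smulRight η)

/-- A volume form on a smooth `n`-manifold: a nowhere vanishing `n`-form that is smooth, that is,
its coefficients with respect to the coordinate vector fields of every chart are smooth. -/
structure VolumeForm (n : ℕ) (M : Type*) [TopologicalSpace M]
    [ChartedSpace (EuclideanSpace ℝ (Fin n)) M] where
  /-- The value of the form at a point. -/
  toForm : ∀ x : M, (TangentSpace (𝓡 n) x) [⋀^Fin n]→ₗ[ℝ] ℝ
  smooth : ∀ (x₀ : M) (v : Fin n → EuclideanSpace ℝ (Fin n)),
    ContDiffOn ℝ ∞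
      (fun y => toForm ((extChartAt (𝓡 n) x₀).symm y)
        (fun i => mfderiv 𝓘(ℝ, EuclideanSpace ℝ (Fin n)) (𝓡 n)
          (extChartAt (𝓡 n) x₀).symm y (v i)))
      (extChartAt (𝓡 n) x₀).target
  ne_zero : ∀ x : M, toForm x ≠ 0

/-! ### Poisson structures and their symplectic leaves -/

/-- A Poisson bracket on a smooth manifold `M`: a Lie bracket on `C^∞(M)` which is a derivation in
each factor. -/
structure PoissonBracket (n : ℕ) (M : Type*) [TopologicalSpace M]
    [ChartedSpace (EuclideanSpace ℝ (Fin n)) M] where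
  /-- The bracket `{g, h}`, as a bilinear map. -/
  bracket : C^∞⟮𝓡 n, M; ℝ⟯ →ₗ[ℝ] C^∞⟮𝓡 n, M; ℝ⟯ →ₗ[ℝ] C^∞⟮𝓡 n, M; ℝ⟯
  bracket_self : ∀ g, bracket g g = 0
  jacobi : ∀ g h l,
    bracket g (bracket h l) + bracket h (bracket l g) + bracket l (bracket g h) = 0
  leibniz_left : ∀ g h l, bracket (g * h) l = g * bracket h l + h * bracket g l
  leibniz_right : ∀ g h l, bracket l (g * h) = g * bracket l h + h * bracket l g

namespace PoissonBracket

variable {n : ℕ} {M : Type*} [TopologicalSpace M] [ChartedSpace (EuclideanSpace ℝ (Fin n)) M]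

/-- `P.Sharp q α v` says that `v = 𝓑_q(α)`, where `𝓑 : T*M → TM`, `𝓑(α) = π(·, α)`, is the bundle
map of the Poisson bivector `π`, given by `π(dg, dh) = {g, h}`. -/
def Sharp (P : PoissonBracket n M) (q : M) (α : TangentSpace (𝓡 n) q →L[ℝ] ℝ)
    (v : TangentSpace (𝓡 n) q) : Prop :=
  ∃ h : C^∞⟮𝓡 n, M; ℝ⟯, mvfderiv (𝓡 n) h q = α ∧
    ∀ g : C^∞⟮𝓡 n, M; ℝ⟯, mvfderiv (𝓡 n) g q v = P.bracket g h q

/-- The characteristic distribution `D_q = 𝓑_q(T*_q M)`; equivalently, the values at `q` of the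
Hamiltonian vector fields `X_h = {·, h}`. -/
def charDist (P : PoissonBracket n M) (q : M) : Submodule ℝ (TangentSpace (𝓡 n) q) where
  carrier := {v | ∃ h : C^∞⟮𝓡 n, M; ℝ⟯, P.Sharp q (mvfderiv (𝓡 n) h q) v}
  zero_mem' := ⟨0, 0, rfl, fun g => by simp⟩
  add_mem' := by
    rintro v w ⟨-, h, -, hv⟩ ⟨-, l, -, hw⟩
    exact ⟨h + l, h + l, rfl, fun g => by simp [hv g, hw g]⟩
  smul_mem' := by
    rintro c v ⟨-, h, -, hv⟩
    exact ⟨c • h, c • h, rfl, fun g => by simp [hv g]⟩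

/-- `p` and `q` are the endpoints of a (compact) piece of a trajectory of a locally defined
Hamiltonian vector field `X_h = 𝓑(dh)`, with `h` smooth on an open set `U`. -/
def HamiltonianStep (P : PoissonBracket n M) (p q : M) : Prop :=
  ∃ (U : Set M) (h : M → ℝ) (X : ∀ x : M, TangentSpace (𝓡 n) x) (γ : ℝ → M) (a b : ℝ),
    IsOpen U ∧ ContMDiffOn (𝓡 n) 𝓘(ℝ, ℝ) ∞ h U ∧
    (∀ x ∈ U, P.Sharp x (mvfderiv (𝓡 n) h x) (X x)) ∧
    a ≤ b ∧ γ a = p ∧ γ b = q ∧ (∀ t ∈ Set.Icc a b, γ t ∈ U) ∧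
    IsMIntegralCurveOn γ X (Set.Icc a b)

/-- The symplectic leaf through `q`: all points that can be joined with `q` by a piecewise smooth
curve each of whose pieces is a trajectory of a locally defined Hamiltonian vector field. (Steps can
be reversed, by changing the sign of the Hamiltonian.) -/
def leaf (P : PoissonBracket n M) (q : M) : Set M :=
  {p | Relation.ReflTransGen P.HamiltonianStep q p}

/-- `L` is an embedded `d`-dimensional submanifold of `M` that is an integral manifold of the
distribution `D`: around each of its points it is a `d`-dimensional slice of a chart of `M`, and its
tangent spaces are the spaces `D x`. -/
def IsIntegralSubmanifold (D : ∀ x : M, Submodule ℝ (TangentSpace (𝓡 n) x)) (d : ℕ)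
    (L : Set M) : Prop :=
  ∀ p ∈ L, ∃ φ ∈ IsManifold.maximalAtlas (𝓡 n) ∞ M, p ∈ φ.source ∧
    ∃ W : Submodule ℝ (EuclideanSpace ℝ (Fin n)), Module.finrank ℝ W = d ∧
      ∀ x ∈ φ.source, (x ∈ L ↔ φ x - φ p ∈ W) ∧
        (x ∈ L → ∀ v : TangentSpace (𝓡 n) x, v ∈ D x ↔ mvfderiv (𝓡 n) φ x v ∈ W)

/-- `L` is a symplectic leaf of `P`, and it is a `d`-dimensional submanifold of `M` tangent to the
characteristic distribution. -/
def IsSymplecticLeaf (P : PoissonBracket n M) (d : ℕ) (L : Set M) : Prop :=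
  (∃ q, L = P.leaf q) ∧ IsIntegralSubmanifold P.charDist d L

end PoissonBracket

/-! ### Critical points, and the bracket defined by a map -/

/-- `L` is a connected component of the subspace `S`. -/
def IsComponentOf {X : Type*} [TopologicalSpace X] (L S : Set X) : Prop :=
  ∃ x ∈ S, L = connectedComponentIn S x

section Map

variable {m : ℕ} {M : Type*} [TopologicalSpace M]
  [ChartedSpace (EuclideanSpace ℝ (Fin (m + 2))) M]
  {N : Type*} [TopologicalSpace N] [ChartedSpace (EuclideanSpace ℝ (Fin m)) N]

/-- The set `C` of critical points of `f`: the points at which `df` is not surjective. -/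
def criticalSet (f : C^∞⟮𝓡 (m + 2), M; 𝓡 m, N⟯) : Set M :=
  {x | ¬ Function.Surjective (mfderiv (𝓡 (m + 2)) (𝓡 m) f x)}

/-- `s` is a singular (critical) value of `f`: the image of a critical point. The other points of
`N` are the regular values. -/
def IsSingularValue (f : C^∞⟮𝓡 (m + 2), M; 𝓡 m, N⟯) (s : N) : Prop :=
  ∃ x ∈ criticalSet f, f x = s

/-- The operation `br` on `C^∞(M)` satisfies `{g, h} μ = k dg ∧ dh ∧ f^*Ω`. -/
def SatisfiesFormula (μ : VolumeForm (m + 2) M) (Ω : VolumeForm m N)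
    (f : C^∞⟮𝓡 (m + 2), M; 𝓡 m, N⟯) (k : C^∞⟮𝓡 (m + 2), M; ℝ⟯)
    (br : C^∞⟮𝓡 (m + 2), M; ℝ⟯ → C^∞⟮𝓡 (m + 2), M; ℝ⟯ → C^∞⟮𝓡 (m + 2), M; ℝ⟯) : Prop :=
  ∀ (g h : C^∞⟮𝓡 (m + 2), M; ℝ⟯) (x : M),
    br g h x • μ.toForm x =
      k x • covectorWedge (mvfderiv (𝓡 (m + 2)) g x).toLinearMap
        (covectorWedge (mvfderiv (𝓡 (m + 2)) h x).toLinearMap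
          ((Ω.toForm (f x)).compLinearMap
            (mfderiv (𝓡 (m + 2)) (𝓡 m) f x).toLinearMap))

end Map

end

/-!
The bracket is given by the bivector `π` with `π(α, β) μ = k α ∧ β ∧ f^*Ω`, which vanishes exactly
on `Z = C ∪ {k = 0}`. Near a point outside `Z` the implicit function theorem gives charts in which
`f` forgets the first two coordinates; there `π = c ∂₀ ∧ ∂₁` with `c ≠ 0`, and the Jacobi identity
is a computation in two variables, while at the points of `Z` it is trivial.

Since `α ∧ β ∧ f^*Ω` vanishes when `β` is pulled back along `f`, Hamiltonian vector fields are
tangent to the fibres of `f`, so trajectories stay in a fibre. They do not enter `Z`, because a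
smooth field that vanishes at a point has only the constant trajectory through it. Conversely, in
one of the above charts, taken with convex image, the segment joining two points of a fibre is a
trajectory, so the leaves are open in the fibres with `Z` removed.
-/

noncomputable section

section Wedge

variable {V W : Type*} [AddCommGroup V] [Module ℝ V] [AddCommGroup W] [Module ℝ W] {p : ℕ}

lemma covectorWedge_apply (α : V →ₗ[ℝ] ℝ) (η : V [⋀^Fin p]→ₗ[ℝ] ℝ) (v : Fin (p + 1) → V) :
    covectorWedge α η v = ∑ i : Fin (p + 1), (-1) ^ (i : ℕ) * (α (v i) * η (i.removeNth v)) := by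
  simp [covectorWedge, AlternatingMap.alternatizeUncurryFin_apply]

lemma covectorWedge_add_left (α β : V →ₗ[ℝ] ℝ) (η : V [⋀^Fin p]→ₗ[ℝ] ℝ) :
    covectorWedge (α + β) η = covectorWedge α η + covectorWedge β η := by
  ext v
  simp [covectorWedge_apply, add_mul, mul_add, Finset.sum_add_distrib]

lemma covectorWedge_smul_left (c : ℝ) (α : V →ₗ[ℝ] ℝ) (η : V [⋀^Fin p]→ₗ[ℝ] ℝ) :
    covectorWedge (c • α) η = c • covectorWedge α η := by
  ext v
  simp [covectorWedge_apply, Finset.mul_sum, mul_assoc, mul_left_comm c]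

lemma covectorWedge_add_right (α : V →ₗ[ℝ] ℝ) (η ζ : V [⋀^Fin p]→ₗ[ℝ] ℝ) :
    covectorWedge α (η + ζ) = covectorWedge α η + covectorWedge α ζ := by
  ext v
  simp [covectorWedge_apply, mul_add, Finset.sum_add_distrib]

lemma covectorWedge_smul_right (c : ℝ) (α : V →ₗ[ℝ] ℝ) (η : V [⋀^Fin p]→ₗ[ℝ] ℝ) :
    covectorWedge α (c • η) = c • covectorWedge α η := by
  ext v
  simp [covectorWedge_apply, Finset.mul_sum, mul_left_comm c]

lemma covectorWedge_covectorWedge_self (α : V →ₗ[ℝ] ℝ) (η : V [⋀^Fin p]→ₗ[ℝ] ℝ) :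
    covectorWedge α (covectorWedge α η) = 0 := by
  have h : α.smulRight (covectorWedge α η) =
      AlternatingMap.alternatizeUncurryFinLM ∘ₗ α.smulRight (α.smulRight η) := by
    ext v w
    simp [covectorWedge]
  rw [covectorWedge, h]
  refine AlternatingMap.alternatizeUncurryFin_alternatizeUncurryFinLM_comp_of_symmetric
    fun v w => ?_
  ext u
  simp [mul_left_comm]

lemma covectorWedge_compLinearMap (α : W →ₗ[ℝ] ℝ) (η : W [⋀^Fin p]→ₗ[ℝ] ℝ) (A : V →ₗ[ℝ] W) :
    covectorWedge (α ∘ₗ A) (η.compLinearMap A) = (covectorWedge α η).compLinearMap A := by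
  ext v
  simp only [covectorWedge_apply, AlternatingMap.compLinearMap_apply, LinearMap.comp_apply]
  rfl

lemma covectorWedge_cons {α : V →ₗ[ℝ] ℝ} {v : Fin p → V} (hα : ∀ i, α (v i) = 0)
    (η : V [⋀^Fin p]→ₗ[ℝ] ℝ) (x : V) :
    covectorWedge α η (Fin.cons x v : Fin (p + 1) → V) = α x * η v := by
  simp [covectorWedge_apply, Fin.sum_univ_succ, hα]

lemma alternatingMap_eq_zero_of_finrank_lt [FiniteDimensional ℝ V]
    (h : Module.finrank ℝ V < p) (η : V [⋀^Fin p]→ₗ[ℝ] ℝ) : η = 0 := by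
  ext v
  refine η.map_linearDependent v fun hv => ?_
  simpa using hv.fintype_card_le_finrank.trans_lt h

lemma compLinearMap_eq_zero_of_not_surjective [FiniteDimensional ℝ W]
    (hW : Module.finrank ℝ W = p) {A : V →ₗ[ℝ] W} (hA : ¬ Function.Surjective A)
    (η : W [⋀^Fin p]→ₗ[ℝ] ℝ) : η.compLinearMap A = 0 := by
  have hlt : Module.finrank ℝ A.range < p :=
    hW ▸ Submodule.finrank_lt (mt LinearMap.range_eq_top.1 hA)
  have h := alternatingMap_eq_zero_of_finrank_lt hlt (η.compLinearMap A.range.subtype)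
  ext v
  exact congr($h fun i => A.rangeRestrict (v i))

lemma apply_mul_apply_comm [FiniteDimensional ℝ V] (hV : Module.finrank ℝ V = p)
    (η μ : V [⋀^Fin p]→ₗ[ℝ] ℝ) (v w : Fin p → V) : μ v * η w = η v * μ w := by
  let b := Module.finBasisOfFinrankEq ℝ V hV
  rw [η.eq_smul_basis_det b, μ.eq_smul_basis_det b]
  simp only [AlternatingMap.smul_apply, smul_eq_mul]
  ring

/-- The bilinear map `(α, β) ↦ α ∧ β ∧ A^*η` on covectors. -/
def wedgePullback (A : V →ₗ[ℝ] W) (η : W [⋀^Fin p]→ₗ[ℝ] ℝ) :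
    (V →ₗ[ℝ] ℝ) →ₗ[ℝ] (V →ₗ[ℝ] ℝ) →ₗ[ℝ] V [⋀^Fin (p + 2)]→ₗ[ℝ] ℝ :=
  LinearMap.mk₂ ℝ (fun α β => covectorWedge α (covectorWedge β (η.compLinearMap A)))
    (fun α α' β => covectorWedge_add_left α α' _)
    (fun c α β => covectorWedge_smul_left c α _)
    (fun α β β' => by rw [covectorWedge_add_left, covectorWedge_add_right])
    (fun c α β => by rw [covectorWedge_smul_left, covectorWedge_smul_right])

lemma wedgePullback_apply (A : V →ₗ[ℝ] W) (η : W [⋀^Fin p]→ₗ[ℝ] ℝ) (α β : V →ₗ[ℝ] ℝ) :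
    wedgePullback A η α β = covectorWedge α (covectorWedge β (η.compLinearMap A)) :=
  rfl

lemma wedgePullback_isAlt (A : V →ₗ[ℝ] W) (η : W [⋀^Fin p]→ₗ[ℝ] ℝ) : (wedgePullback A η).IsAlt :=
  fun α => covectorWedge_covectorWedge_self α _

lemma wedgePullback_cons_cons {A : V →ₗ[ℝ] W} {α β : V →ₗ[ℝ] ℝ} {v : V} {w : Fin p → V}
    (hαv : α v = 0) (hαw : ∀ i, α (w i) = 0) (hβw : ∀ i, β (w i) = 0)
    (η : W [⋀^Fin p]→ₗ[ℝ] ℝ) (u : V) :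
    wedgePullback A η α β (Fin.cons u (Fin.cons v w : Fin (p + 1) → V) : Fin (p + 2) → V) =
      α u * (β v * η (A ∘ w)) := by
  rw [wedgePullback_apply, covectorWedge_cons (Fin.cases hαv hαw), covectorWedge_cons hβw]
  rfl

variable [FiniteDimensional ℝ W]

lemma wedgePullback_comp_right (hW : Module.finrank ℝ W = p) (A : V →ₗ[ℝ] W)
    (η : W [⋀^Fin p]→ₗ[ℝ] ℝ) (α : V →ₗ[ℝ] ℝ) (β : W →ₗ[ℝ] ℝ) :
    wedgePullback A η α (β ∘ₗ A) = 0 := by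
  rw [wedgePullback_apply, covectorWedge_compLinearMap,
    alternatingMap_eq_zero_of_finrank_lt (by omega) (covectorWedge β η)]
  ext v
  simp [covectorWedge_apply]

lemma wedgePullback_eq_smul (hW : Module.finrank ℝ W = p) {A : V →ₗ[ℝ] W}
    {θ₀ θ₁ : V →ₗ[ℝ] ℝ} {u v : V}
    (hspan : ∀ α : V →ₗ[ℝ] ℝ, ∃ κ : W →ₗ[ℝ] ℝ, α = α u • θ₀ + α v • θ₁ + κ ∘ₗ A)
    (η : W [⋀^Fin p]→ₗ[ℝ] ℝ) (α β : V →ₗ[ℝ] ℝ) :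
    wedgePullback A η α β = (α u * β v - α v * β u) • wedgePullback A η θ₀ θ₁ := by
  have hself := wedgePullback_isAlt A η
  have hleft (κ : W →ₗ[ℝ] ℝ) (β : V →ₗ[ℝ] ℝ) : wedgePullback A η (κ ∘ₗ A) β = 0 := by
    rw [← hself.neg, wedgePullback_comp_right hW, neg_zero]
  obtain ⟨κ, hα⟩ := hspan α
  obtain ⟨κ', hβ⟩ := hspan β
  conv_lhs => rw [hα, hβ]
  simp only [map_add, map_smul, LinearMap.add_apply, LinearMap.smul_apply, hself θ₀, hself θ₁,
    ← hself.neg θ₀ θ₁, hleft, wedgePullback_comp_right hW]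
  module

lemma wedgePullback_eq_zero_of_not_surjective (hW : Module.finrank ℝ W = p) {A : V →ₗ[ℝ] W}
    (hA : ¬ Function.Surjective A) (η : W [⋀^Fin p]→ₗ[ℝ] ℝ) : wedgePullback A η = 0 := by
  ext α β v
  simp [wedgePullback_apply, compLinearMap_eq_zero_of_not_surjective hW hA, covectorWedge_apply]

end Wedge

section Charts

variable {E : Type*} [NormedAddCommGroup E] [NormedSpace ℝ E]
  {M : Type*} [TopologicalSpace M] [ChartedSpace E M]
  {F : Type*} [NormedAddCommGroup F] [NormedSpace ℝ F]

instance finiteDimensional_tangentSpace [FiniteDimensional ℝ E] (x : M) :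
    FiniteDimensional ℝ (TangentSpace 𝓘(ℝ, E) x) :=
  inferInstanceAs (FiniteDimensional ℝ E)

instance t2Space_tangentSpace (x : M) : T2Space (TangentSpace 𝓘(ℝ, E) x) :=
  inferInstanceAs (T2Space E)

lemma finrank_tangentSpace_euclidean {n : ℕ} [ChartedSpace (EuclideanSpace ℝ (Fin n)) M] (x : M) :
    Module.finrank ℝ (TangentSpace (𝓡 n) x) = n :=
  finrank_euclideanSpace_fin

lemma mdifferentiable_of_mem_maximalAtlas {φ : OpenPartialHomeomorph M E}
    (hφ : φ ∈ IsManifold.maximalAtlas 𝓘(ℝ, E) ∞ M) : φ.MDifferentiable 𝓘(ℝ, E) 𝓘(ℝ, E) :=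
  ⟨(contMDiffOn_of_mem_maximalAtlas hφ).mdifferentiableOn (by simp),
    (contMDiffOn_symm_of_mem_maximalAtlas hφ).mdifferentiableOn (by simp)⟩

lemma contDiffAt_comp_symm {φ : OpenPartialHomeomorph M E}
    (hφ : φ ∈ IsManifold.maximalAtlas 𝓘(ℝ, E) ∞ M) {x : M} (hx : x ∈ φ.source) {g : M → F}
    (hg : ContMDiffAt 𝓘(ℝ, E) 𝓘(ℝ, F) ∞ g x) : ContDiffAt ℝ ∞ (g ∘ φ.symm) (φ x) := by
  rw [← contMDiffAt_iff_contDiffAt]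
  refine ContMDiffAt.comp (φ x) ?_ (contMDiffAt_symm_of_mem_maximalAtlas hφ (φ.map_source hx))
  rwa [φ.left_inv hx]

lemma mvfderiv_clm_comp {G : Type*} [NormedAddCommGroup G] [NormedSpace ℝ G] (B : F →L[ℝ] G)
    {g : M → F} {x : M} (hg : MDifferentiableAt 𝓘(ℝ, E) 𝓘(ℝ, F) g x) :
    mvfderiv 𝓘(ℝ, E) (B ∘ g) x = B ∘L mvfderiv 𝓘(ℝ, E) g x := by
  have h := mfderiv_comp x B.mdifferentiableAt hg
  rwa [mfderiv_eq_fderiv, ContinuousLinearMap.fderiv] at h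

/-- The coordinate vector field of the chart `φ` in the direction `v`. Its value at `x` is
`d(φ⁻¹)_{φ x} v`, and is meaningful on the domain of `φ`. -/
def coordField (φ : OpenPartialHomeomorph M E) (v : E) (x : M) : TangentSpace 𝓘(ℝ, E) x :=
  mfderiv 𝓘(ℝ, E) 𝓘(ℝ, E) φ.symm (φ x) v

lemma coordField_add (φ : OpenPartialHomeomorph M E) (u v : E) (x : M) :
    coordField φ (u + v) x = coordField φ u x + coordField φ v x :=
  map_add (mfderiv 𝓘(ℝ, E) 𝓘(ℝ, E) φ.symm (φ x)) u v

lemma coordField_smul (φ : OpenPartialHomeomorph M E) (c : ℝ) (v : E) (x : M) :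
    coordField φ (c • v) x = c • coordField φ v x :=
  map_smul (mfderiv 𝓘(ℝ, E) 𝓘(ℝ, E) φ.symm (φ x)) c v

/-- The derivative of `g` at `x` along the coordinate vector field `coordField φ v`, that is, the
partial derivative of `g` in the chart `φ`. -/
def coordDeriv (φ : OpenPartialHomeomorph M E) (v : E) (g : M → F) (x : M) : F :=
  mvfderiv 𝓘(ℝ, E) g x (coordField φ v x)

section

variable {φ : OpenPartialHomeomorph M E} (hφ : φ ∈ IsManifold.maximalAtlas 𝓘(ℝ, E) ∞ M) {x : M}
  (hx : x ∈ φ.source)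

include hφ hx

lemma mvfderiv_coordField (v : E) : mvfderiv 𝓘(ℝ, E) φ x (coordField φ v x) = v :=
  ((mdifferentiable_of_mem_maximalAtlas hφ).mfderiv hx).apply_symm_apply v

lemma coordField_mvfderiv (v : TangentSpace 𝓘(ℝ, E) x) :
    coordField φ (mvfderiv 𝓘(ℝ, E) φ x v) x = v :=
  ((mdifferentiable_of_mem_maximalAtlas hφ).mfderiv hx).symm_apply_apply v

lemma coordDeriv_eq_fderiv {g : M → F} (hg : MDifferentiableAt 𝓘(ℝ, E) 𝓘(ℝ, F) g x) (v : E) :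
    coordDeriv φ v g x = fderiv ℝ (g ∘ φ.symm) (φ x) v := by
  have hsymm := (mdifferentiable_of_mem_maximalAtlas hφ).mdifferentiableAt_symm (φ.map_source hx)
  have hpoint : (mfderiv 𝓘(ℝ, E) 𝓘(ℝ, F) g (φ.symm (φ x)) : E →L[ℝ] F) =
      mfderiv 𝓘(ℝ, E) 𝓘(ℝ, F) g x := by
    rw [φ.left_inv hx]
  have hchain := mfderiv_comp_of_eq hg hsymm (φ.left_inv hx)
  rw [mfderiv_eq_fderiv] at hchain
  rw [coordDeriv, hchain]
  exact congr($hpoint.symm (coordField φ v x))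

lemma mvfderiv_eq_fderiv_mvfderiv {g : M → F} (hg : MDifferentiableAt 𝓘(ℝ, E) 𝓘(ℝ, F) g x)
    (v : TangentSpace 𝓘(ℝ, E) x) :
    mvfderiv 𝓘(ℝ, E) g x v = fderiv ℝ (g ∘ φ.symm) (φ x) (mvfderiv 𝓘(ℝ, E) φ x v) := by
  rw [← coordDeriv_eq_fderiv hφ hx hg, coordDeriv, coordField_mvfderiv hφ hx]

lemma exists_basis_coordField {ι : Type*} (b : Module.Basis ι ℝ E) :
    ∃ b' : Module.Basis ι ℝ (TangentSpace 𝓘(ℝ, E) x), ∀ i, b' i = coordField φ (b i) x :=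
  ⟨b.map ((mdifferentiable_of_mem_maximalAtlas hφ).mfderiv hx).symm.toLinearEquiv,
    fun i => b.map_apply _ i⟩

variable [IsManifold 𝓘(ℝ, E) ∞ M]

lemma eventually_coordDeriv_eq_fderiv {g : M → F}
    (hg : ContMDiffAt 𝓘(ℝ, E) 𝓘(ℝ, F) ∞ g x) (v : E) :
    coordDeriv φ v g =ᶠ[nhds x] (fun z => fderiv ℝ (g ∘ φ.symm) z v) ∘ φ := by
  have : IsManifold 𝓘(ℝ, E) 1 M := IsManifold.of_le (n := ∞) (by simp)
  have hdiff := (contMDiffAt_iff_contMDiffAt_nhds (by simp)).1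
    (hg.of_le (by simp : (1 : WithTop ℕ∞) ≤ ∞))
  filter_upwards [hdiff, φ.open_source.mem_nhds hx] with y hy hyφ
  exact coordDeriv_eq_fderiv hφ hyφ (hy.mdifferentiableAt (by simp)) v

lemma contMDiffAt_coordDeriv {g : M → F} (hg : ContMDiffAt 𝓘(ℝ, E) 𝓘(ℝ, F) ∞ g x) (v : E) :
    ContMDiffAt 𝓘(ℝ, E) 𝓘(ℝ, F) ∞ (coordDeriv φ v g) x := by
  refine ContMDiffAt.congr_of_eventuallyEq ?_ (eventually_coordDeriv_eq_fderiv hφ hx hg v)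
  have hfderiv : ContDiffAt ℝ ∞ (fderiv ℝ (g ∘ φ.symm)) (φ x) :=
    (contDiffAt_comp_symm hφ hx hg).fderiv_right (by simp)
  exact ContMDiffAt.comp x (hfderiv.clm_apply contDiffAt_const).contMDiffAt
    (contMDiffAt_of_mem_maximalAtlas hφ hx)

lemma coordDeriv_comm {g : M → F} (hg : ContMDiffAt 𝓘(ℝ, E) 𝓘(ℝ, F) ∞ g x) (u v : E) :
    coordDeriv φ v (coordDeriv φ u g) x = coordDeriv φ u (coordDeriv φ v g) x := by
  have hG := contDiffAt_comp_symm hφ hx hg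
  have hfderiv : DifferentiableAt ℝ (fderiv ℝ (g ∘ φ.symm)) (φ x) :=
    (hG.fderiv_right (m := ∞) (by simp)).differentiableAt (by simp)
  have hsecond (u v : E) :
      coordDeriv φ v (coordDeriv φ u g) x = fderiv ℝ (fderiv ℝ (g ∘ φ.symm)) (φ x) v u := by
    have hchart : coordDeriv φ u g ∘ φ.symm =ᶠ[nhds (φ x)]
        fun z => fderiv ℝ (g ∘ φ.symm) z u := by
      have hsymm := φ.symm.continuousAt (φ.map_source hx)
      rw [ContinuousAt, φ.left_inv hx] at hsymm
      filter_upwards [hsymm.eventually (eventually_coordDeriv_eq_fderiv hφ hx hg u),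
        φ.open_target.mem_nhds (φ.map_source hx)] with z hz hzt
      simpa [φ.right_inv hzt] using hz
    have hdiff := (contMDiffAt_coordDeriv hφ hx hg u).mdifferentiableAt (by simp)
    rw [coordDeriv_eq_fderiv hφ hx hdiff, hchart.fderiv_eq,
      fderiv_clm_apply hfderiv (differentiableAt_const u)]
    simp
  rw [hsecond, hsecond]
  exact (hG.isSymmSndFDerivAt (by simpa using ENat.LEInfty.out)).eq v u

end

end Charts

section Smoothness

variable {E : Type*} [NormedAddCommGroup E] [NormedSpace ℝ E]
  {M : Type*} [TopologicalSpace M] [ChartedSpace E M] {x₀ : M}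

lemma contMDiffAt_det {ι : Type*} [Fintype ι] [DecidableEq ι] {A : M → Matrix ι ι ℝ}
    (hA : ∀ i j, ContMDiffAt 𝓘(ℝ, E) 𝓘(ℝ, ℝ) ∞ (fun x => A x i j) x₀) :
    ContMDiffAt 𝓘(ℝ, E) 𝓘(ℝ, ℝ) ∞ (fun x => (A x).det) x₀ := by
  simp only [Matrix.det_apply']
  exact contMDiffAt_finsetSum fun σ _ =>
    contMDiffAt_const.mul (contMDiffAt_finsetProd fun i _ => hA (σ i) i)

lemma contMDiffAt_covectorWedge {p : ℕ} {α : ∀ x : M, TangentSpace 𝓘(ℝ, E) x →ₗ[ℝ] ℝ}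
    {η : ∀ x : M, TangentSpace 𝓘(ℝ, E) x [⋀^Fin p]→ₗ[ℝ] ℝ}
    {v : Fin (p + 1) → ∀ x : M, TangentSpace 𝓘(ℝ, E) x}
    (hα : ∀ i, ContMDiffAt 𝓘(ℝ, E) 𝓘(ℝ, ℝ) ∞ (fun x => α x (v i x)) x₀)
    (hη : ∀ i : Fin (p + 1),
      ContMDiffAt 𝓘(ℝ, E) 𝓘(ℝ, ℝ) ∞ (fun x => η x fun j => v (i.succAbove j) x) x₀) :
    ContMDiffAt 𝓘(ℝ, E) 𝓘(ℝ, ℝ) ∞ (fun x => covectorWedge (α x) (η x) fun i => v i x) x₀ := by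
  simp only [covectorWedge_apply]
  exact contMDiffAt_finsetSum fun i _ => contMDiffAt_const.mul ((hα i).mul (hη i))

lemma VolumeForm.contMDiffAt_coordField {m : ℕ} {N : Type*} [TopologicalSpace N]
    [ChartedSpace (EuclideanSpace ℝ (Fin m)) N] [IsManifold (𝓡 m) ∞ N] (Ω : VolumeForm m N)
    (y : N) (v : Fin m → EuclideanSpace ℝ (Fin m)) :
    ContMDiffAt (𝓡 m) 𝓘(ℝ, ℝ) ∞
      (fun z => Ω.toForm z fun i => coordField (chartAt _ y) (v i) z) y := by
  have hψ := IsManifold.chart_mem_maximalAtlas (I := 𝓡 m) (n := ∞) y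
  have hy := mem_chart_source (EuclideanSpace ℝ (Fin m)) y
  have hΩ := (Ω.smooth y v).contDiffAt ((isOpen_extChartAt_target y).mem_nhds
    ((extChartAt (𝓡 m) y).map_source (mem_extChartAt_source y)))
  refine (hΩ.contMDiffAt.comp y (contMDiffAt_of_mem_maximalAtlas hψ hy)).congr_of_eventuallyEq ?_
  have htransport (z z' : N) (hz : z' = z) (u : Fin m → EuclideanSpace ℝ (Fin m)) :
      Ω.toForm z u = Ω.toForm z' u := by
    subst hz
    rfl
  filter_upwards [(chartAt (EuclideanSpace ℝ (Fin m)) y).open_source.mem_nhds hy] with z hz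
  exact htransport z _ ((chartAt (EuclideanSpace ℝ (Fin m)) y).left_inv hz) _

lemma VolumeForm.contMDiffAt_apply {m : ℕ} {N : Type*} [TopologicalSpace N]
    [ChartedSpace (EuclideanSpace ℝ (Fin m)) N] [IsManifold (𝓡 m) ∞ N] (Ω : VolumeForm m N)
    {f : M → N} (hf : ContMDiffAt 𝓘(ℝ, E) (𝓡 m) ∞ f x₀)
    {w : Fin m → ∀ x : M, TangentSpace (𝓡 m) (f x)}
    (hw : ∀ i, ContMDiffAt 𝓘(ℝ, E) (𝓡 m) ∞
      (fun x => mvfderiv (𝓡 m) (chartAt (EuclideanSpace ℝ (Fin m)) (f x₀)) (f x) (w i x)) x₀) :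
    ContMDiffAt 𝓘(ℝ, E) 𝓘(ℝ, ℝ) ∞ (fun x => Ω.toForm (f x) fun i => w i x) x₀ := by
  set ψ := chartAt (EuclideanSpace ℝ (Fin m)) (f x₀)
  have hψ : ψ ∈ IsManifold.maximalAtlas (𝓡 m) ∞ N := IsManifold.chart_mem_maximalAtlas (f x₀)
  let b := (EuclideanSpace.basisFun (Fin m) ℝ).toBasis
  have hdet : ContMDiffAt 𝓘(ℝ, E) 𝓘(ℝ, ℝ) ∞
      (fun x => b.det fun i => mvfderiv (𝓡 m) ψ (f x) (w i x)) x₀ :=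
    contMDiffAt_det fun i j =>
      (EuclideanSpace.proj (𝕜 := ℝ) i).contMDiff.contMDiffAt.comp x₀ (hw j)
  refine (((Ω.contMDiffAt_coordField (f x₀) b).comp x₀ hf).mul hdet).congr_of_eventuallyEq ?_
  have hsource := hf.continuousAt (ψ.open_source.mem_nhds (mem_chart_source _ (f x₀)))
  filter_upwards [hsource] with x hx
  let δ : TangentSpace (𝓡 m) (f x) [⋀^Fin m]→ₗ[ℝ] ℝ :=
    b.det.compLinearMap (mvfderiv (𝓡 m) ψ (f x)).toLinearMap
  have hδ : δ (fun i => coordField ψ (b i) (f x)) = 1 :=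
    (congrArg b.det (funext fun i => mvfderiv_coordField hψ hx (b i))).trans b.det_self
  have hratio := apply_mul_apply_comm
    (finrank_tangentSpace_euclidean (f x)) (Ω.toForm (f x)) δ
    (fun i => coordField ψ (b i) (f x)) fun i => w i x
  rw [hδ, one_mul] at hratio
  exact hratio

end Smoothness

section Bivector

variable {m : ℕ} {M : Type*} [TopologicalSpace M]
  [ChartedSpace (EuclideanSpace ℝ (Fin (m + 2))) M]
  {N : Type*} [TopologicalSpace N] [ChartedSpace (EuclideanSpace ℝ (Fin m)) N]
  (μ : VolumeForm (m + 2) M) (Ω : VolumeForm m N)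
  (f : C^∞⟮𝓡 (m + 2), M; 𝓡 m, N⟯) (k : C^∞⟮𝓡 (m + 2), M; ℝ⟯)

/-- The form `α ∧ β ∧ f^*Ω` at the point `x`, for covectors `α` and `β`. -/
def wedgeWithPullback (x : M) (α β : TangentSpace (𝓡 (m + 2)) x →L[ℝ] ℝ) :
    TangentSpace (𝓡 (m + 2)) x [⋀^Fin (m + 2)]→ₗ[ℝ] ℝ :=
  wedgePullback (mfderiv (𝓡 (m + 2)) (𝓡 m) f x).toLinearMap (Ω.toForm (f x))
    α.toLinearMap β.toLinearMap

/-- The bivector `π` with `π(α, β) μ = k α ∧ β ∧ f^*Ω`. The quotient of the two forms of top degree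
is read off from their values on a basis, chosen arbitrarily. -/
def jacobianBivector (x : M) :
    (TangentSpace (𝓡 (m + 2)) x →L[ℝ] ℝ) →ₗ[ℝ] (TangentSpace (𝓡 (m + 2)) x →L[ℝ] ℝ) →ₗ[ℝ] ℝ :=
  let b := Module.finBasisOfFinrankEq ℝ _ (finrank_tangentSpace_euclidean x)
  LinearMap.mk₂ ℝ (fun α β => k x * wedgeWithPullback Ω f x α β b / μ.toForm x b)
    (fun α α' β => by simp [wedgeWithPullback]; ring)
    (fun c α β => by simp [wedgeWithPullback]; ring)
    (fun α β β' => by simp [wedgeWithPullback]; ring)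
    (fun c α β => by simp [wedgeWithPullback]; ring)

variable {μ Ω f k}

lemma VolumeForm.apply_basis_ne_zero {n : ℕ} {M : Type*} [TopologicalSpace M]
    [ChartedSpace (EuclideanSpace ℝ (Fin n)) M] (μ : VolumeForm n M) {x : M}
    (b : Module.Basis (Fin n) ℝ (TangentSpace (𝓡 n) x)) : μ.toForm x b ≠ 0 :=
  mt (AlternatingMap.map_basis_eq_zero_iff b _).1 (μ.ne_zero x)

lemma jacobianBivector_mul_apply (x : M) (α β : TangentSpace (𝓡 (m + 2)) x →L[ℝ] ℝ)
    (v : Fin (m + 2) → TangentSpace (𝓡 (m + 2)) x) :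
    jacobianBivector μ Ω f k x α β * μ.toForm x v = k x * wedgeWithPullback Ω f x α β v := by
  let b : Module.Basis (Fin (m + 2)) ℝ (TangentSpace (𝓡 (m + 2)) x) :=
    Module.finBasisOfFinrankEq ℝ _ (finrank_tangentSpace_euclidean x)
  have hratio := apply_mul_apply_comm (finrank_tangentSpace_euclidean x) (μ.toForm x)
    (wedgeWithPullback Ω f x α β) b v
  rw [jacobianBivector, LinearMap.mk₂_apply, div_mul_eq_mul_div,
    div_eq_iff (μ.apply_basis_ne_zero b)]
  linear_combination k x * hratio

lemma jacobianBivector_self (x : M) (α : TangentSpace (𝓡 (m + 2)) x →L[ℝ] ℝ) :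
    jacobianBivector μ Ω f k x α α = 0 := by
  simp [jacobianBivector, wedgeWithPullback, wedgePullback_isAlt _ _ α.toLinearMap]

lemma jacobianBivector_comp_mfderiv (x : M) (α : TangentSpace (𝓡 (m + 2)) x →L[ℝ] ℝ)
    (β : TangentSpace (𝓡 m) (f x) →L[ℝ] ℝ) :
    jacobianBivector μ Ω f k x α (β ∘L mfderiv (𝓡 (m + 2)) (𝓡 m) f x) = 0 := by
  have h := wedgePullback_comp_right (finrank_tangentSpace_euclidean (f x))
    (mfderiv (𝓡 (m + 2)) (𝓡 m) f x).toLinearMap (Ω.toForm (f x)) α.toLinearMap β.toLinearMap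
  simp [jacobianBivector, wedgeWithPullback, h]

variable (f k) in
/-- The set of points at which `k df ∧ ⋯ ∧ df` vanishes, that is, at which the bivector does: the
critical points of `f` and the zeros of `k`. -/
def degeneracyLocus : Set M :=
  criticalSet f ∪ {x | k x = 0}

lemma jacobianBivector_eq_zero {x : M} (hx : x ∈ degeneracyLocus f k) :
    jacobianBivector μ Ω f k x = 0 := by
  ext α β
  rcases hx with hx | hx
  · have h := wedgePullback_eq_zero_of_not_surjective (finrank_tangentSpace_euclidean (f x))
      (A := (mfderiv (𝓡 (m + 2)) (𝓡 m) f x).toLinearMap) hx (Ω.toForm (f x))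
    simp [jacobianBivector, wedgeWithPullback, h]
  · simp [jacobianBivector, show k x = 0 from hx]

variable [IsManifold (𝓡 (m + 2)) ∞ M] [IsManifold (𝓡 m) ∞ N] {x₀ : M} {g h : M → ℝ}

lemma contMDiffAt_wedgeWithPullback
    (hg : ContMDiffAt (𝓡 (m + 2)) 𝓘(ℝ, ℝ) ∞ g x₀) (hh : ContMDiffAt (𝓡 (m + 2)) 𝓘(ℝ, ℝ) ∞ h x₀)
    (v : Fin (m + 2) → EuclideanSpace ℝ (Fin (m + 2))) :
    ContMDiffAt (𝓡 (m + 2)) 𝓘(ℝ, ℝ) ∞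
      (fun x => wedgeWithPullback Ω f x (mvfderiv (𝓡 (m + 2)) g x) (mvfderiv (𝓡 (m + 2)) h x)
        fun i => coordField (chartAt _ x₀) (v i) x) x₀ := by
  have hφ := IsManifold.chart_mem_maximalAtlas (I := 𝓡 (m + 2)) (n := ∞) x₀
  have hx₀ := mem_chart_source (EuclideanSpace ℝ (Fin (m + 2))) x₀
  have hf : ContMDiffAt (𝓡 (m + 2)) (𝓡 m) ∞ f x₀ := f.contMDiff x₀
  set ψ := chartAt (EuclideanSpace ℝ (Fin m)) (f x₀)
  have hψ : ψ ∈ IsManifold.maximalAtlas (𝓡 m) ∞ N := IsManifold.chart_mem_maximalAtlas (f x₀)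
  have hψf : ContMDiffAt (𝓡 (m + 2)) (𝓡 m) ∞ (ψ ∘ f) x₀ :=
    (contMDiffAt_of_mem_maximalAtlas hψ (mem_chart_source _ (f x₀))).comp x₀ hf
  refine contMDiffAt_covectorWedge
    (fun i => contMDiffAt_coordDeriv hφ hx₀ hg (v i)) fun i =>
    contMDiffAt_covectorWedge
      (fun j => contMDiffAt_coordDeriv hφ hx₀ hh (v (i.succAbove j))) fun j =>
    Ω.contMDiffAt_apply hf fun l => ?_
  refine (contMDiffAt_coordDeriv hφ hx₀ hψf
    (v (i.succAbove (j.succAbove l)))).congr_of_eventuallyEq ?_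
  filter_upwards [hf.continuousAt (ψ.open_source.mem_nhds (mem_chart_source _ (f x₀)))] with x hx
  exact (mfderiv_comp_apply (g := ψ) x
    ((mdifferentiable_of_mem_maximalAtlas hψ).mdifferentiableAt hx)
    (f.contMDiff.mdifferentiable (by simp) x) _).symm

lemma contMDiffAt_jacobianBivector
    (hg : ContMDiffAt (𝓡 (m + 2)) 𝓘(ℝ, ℝ) ∞ g x₀)
    (hh : ContMDiffAt (𝓡 (m + 2)) 𝓘(ℝ, ℝ) ∞ h x₀) :
    ContMDiffAt (𝓡 (m + 2)) 𝓘(ℝ, ℝ) ∞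
      (fun x => jacobianBivector μ Ω f k x (mvfderiv (𝓡 (m + 2)) g x)
        (mvfderiv (𝓡 (m + 2)) h x)) x₀ := by
  set φ := chartAt (EuclideanSpace ℝ (Fin (m + 2))) x₀
  have hφ : φ ∈ IsManifold.maximalAtlas (𝓡 (m + 2)) ∞ M := IsManifold.chart_mem_maximalAtlas x₀
  let b := (EuclideanSpace.basisFun (Fin (m + 2)) ℝ).toBasis
  have hμ {x : M} (hx : x ∈ φ.source) : μ.toForm x (fun i => coordField φ (b i) x) ≠ 0 := by
    obtain ⟨b', hb'⟩ := exists_basis_coordField hφ hx b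
    simpa only [← funext hb'] using μ.apply_basis_ne_zero b'
  refine ((k.contMDiff x₀).mul (contMDiffAt_wedgeWithPullback (Ω := Ω) (f := f) hg hh b)).div₀
    (μ.contMDiffAt_coordField x₀ b) (hμ (mem_chart_source _ x₀)) |>.congr_of_eventuallyEq ?_
  filter_upwards [φ.open_source.mem_nhds (mem_chart_source _ x₀)] with x hx
  exact eq_div_of_mul_eq (hμ hx) (jacobianBivector_mul_apply x _ _ _)

variable (μ Ω f k) in
/-- The function `{g, h}`. -/
def jacobianBracket (g h : C^∞⟮𝓡 (m + 2), M; ℝ⟯) : C^∞⟮𝓡 (m + 2), M; ℝ⟯ :=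
  ⟨fun x => jacobianBivector μ Ω f k x (mvfderiv (𝓡 (m + 2)) g x) (mvfderiv (𝓡 (m + 2)) h x),
    fun x => contMDiffAt_jacobianBivector (g.contMDiff x) (h.contMDiff x)⟩

lemma jacobianBracket_apply (g h : C^∞⟮𝓡 (m + 2), M; ℝ⟯) (x : M) :
    jacobianBracket μ Ω f k g h x =
      jacobianBivector μ Ω f k x (mvfderiv (𝓡 (m + 2)) g x) (mvfderiv (𝓡 (m + 2)) h x) :=
  rfl

lemma satisfiesFormula_iff_eq_jacobianBracket
    {br : C^∞⟮𝓡 (m + 2), M; ℝ⟯ → C^∞⟮𝓡 (m + 2), M; ℝ⟯ → C^∞⟮𝓡 (m + 2), M; ℝ⟯} :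
    SatisfiesFormula μ Ω f k br ↔ br = jacobianBracket μ Ω f k := by
  have hformula (g h : C^∞⟮𝓡 (m + 2), M; ℝ⟯) (x : M) :
      jacobianBracket μ Ω f k g h x • μ.toForm x =
        k x • wedgeWithPullback Ω f x (mvfderiv (𝓡 (m + 2)) g x) (mvfderiv (𝓡 (m + 2)) h x) := by
    ext v
    exact jacobianBivector_mul_apply x _ _ v
  constructor
  · intro hbr
    ext g h x
    exact smul_left_injective ℝ (μ.ne_zero x) ((hbr g h x).trans (hformula g h x).symm)
  · rintro rfl
    exact hformula

end Bivector

section NormalForm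

variable {E : Type*} [NormedAddCommGroup E] [NormedSpace ℝ E] [FiniteDimensional ℝ E]
  {F : Type*} [NormedAddCommGroup F] [NormedSpace ℝ F]

lemma exists_continuousLinearEquiv_comp_eq {A B : E →L[ℝ] F} (hA : Function.Surjective A)
    (hB : Function.Surjective B) : ∃ L : E ≃L[ℝ] E, ∀ v, B (L v) = A v := by
  have hker : Module.finrank ℝ A.ker = Module.finrank ℝ B.ker := by
    have hA' := LinearMap.finrank_range_add_finrank_ker A.toLinearMap
    have hB' := LinearMap.finrank_range_add_finrank_ker B.toLinearMap
    rw [LinearMap.range_eq_top.2 hA] at hA'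
    rw [LinearMap.range_eq_top.2 hB] at hB'
    exact Nat.add_left_cancel (hA'.trans hB'.symm)
  let κ := LinearEquiv.ofFinrankEq A.ker B.ker hker
  obtain ⟨P, hP⟩ := LinearMap.exists_leftInverse_of_injective A.ker.subtype
    (Submodule.ker_subtype _)
  obtain ⟨S, hS⟩ := LinearMap.exists_rightInverse_of_surjective B.toLinearMap
    (LinearMap.range_eq_top.2 hB)
  let T : E →ₗ[ℝ] E := S ∘ₗ A.toLinearMap + B.ker.subtype ∘ₗ κ.toLinearMap ∘ₗ P
  have hBT (v : E) : B (T v) = A v := by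
    simpa [T] using LinearMap.congr_fun hS (A v)
  have hT : Function.Injective T := by
    refine (injective_iff_map_eq_zero T).2 fun v hv => ?_
    have hAv : A v = 0 := by rw [← hBT, hv, map_zero]
    have hPv : P v = ⟨v, hAv⟩ := LinearMap.congr_fun hP ⟨v, hAv⟩
    have hκ : κ (P v) = 0 := Subtype.ext (by simpa [T, hAv] using hv)
    rw [κ.map_eq_zero_iff, hPv] at hκ
    exact congrArg Subtype.val hκ
  exact ⟨(LinearEquiv.ofInjectiveEndo T hT).toContinuousLinearEquiv, hBT⟩

lemma exists_openPartialHomeomorph_of_contDiffOn {Φ : E → E} {U : Set E} (hU : IsOpen U)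
    (hΦ : ContDiffOn ℝ ∞ Φ U) {a : E} (ha : a ∈ U) {L : E ≃L[ℝ] E}
    (hL : HasFDerivAt Φ (L : E →L[ℝ] E) a) :
    ∃ R : OpenPartialHomeomorph E E, ⇑R = Φ ∧ a ∈ R.source ∧ R.source ⊆ U ∧
      ContDiffOn ℝ ∞ R.symm R.target := by
  have := FiniteDimensional.complete ℝ E
  have hΦa : ContDiffAt ℝ ∞ Φ a := hΦ.contDiffAt (hU.mem_nhds ha)
  have hopen : IsOpen (U ∩ fderiv ℝ Φ ⁻¹' Set.range ((↑) : (E ≃L[ℝ] E) → E →L[ℝ] E)) :=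
    (hΦ.continuousOn_fderiv_of_isOpen hU (by simp)).isOpen_inter_preimage hU
      ContinuousLinearEquiv.isOpen
  let R := (hΦa.toOpenPartialHomeomorph Φ hL (by simp)).restrOpen _ hopen
  refine ⟨R, rfl, ⟨hΦa.mem_toOpenPartialHomeomorph_source hL (by simp), ha, L, hL.fderiv.symm⟩,
    fun x hx => hx.2.1, fun z hz => ?_⟩
  obtain ⟨-, hzU, L', hL'⟩ := R.map_target hz
  have hΦz : ContDiffAt ℝ ∞ Φ (R.symm z) := hΦ.contDiffAt (hU.mem_nhds hzU)
  refine (R.contDiffAt_symm hz (f₀' := L') ?_ hΦz).contDiffWithinAt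
  rw [hL']
  exact (hΦz.differentiableAt (by simp)).hasFDerivAt

-- The coordinate change is `y ↦ L y + S (G y - dG y)`, where `B L = dG` and `B S = id`.
lemma exists_openPartialHomeomorph_linearizing {G : E → F} {U : Set E} (hU : IsOpen U)
    (hG : ContDiffOn ℝ ∞ G U) {a : E} (ha : a ∈ U) (hGa : Function.Surjective (fderiv ℝ G a))
    {B : E →L[ℝ] F} (hB : Function.Surjective B) :
    ∃ R : OpenPartialHomeomorph E E, a ∈ R.source ∧ R.source ⊆ U ∧
      ContDiffOn ℝ ∞ R R.source ∧ ContDiffOn ℝ ∞ R.symm R.target ∧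
      ∀ y ∈ R.source, B (R y) = G y := by
  obtain ⟨L, hL⟩ := exists_continuousLinearEquiv_comp_eq hGa hB
  have : FiniteDimensional ℝ F := Module.Finite.of_surjective B.toLinearMap hB
  obtain ⟨S, hS⟩ := LinearMap.exists_rightInverse_of_surjective B.toLinearMap
    (LinearMap.range_eq_top.2 hB)
  let S' : F →L[ℝ] E := LinearMap.toContinuousLinearMap S
  let Φ (y : E) : E := L y + S' (G y - fderiv ℝ G a y)
  have hΦ : ContDiffOn ℝ ∞ Φ U :=
    L.contDiff.contDiffOn.add (S'.contDiff.comp_contDiffOn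
      (hG.sub (fderiv ℝ G a).contDiff.contDiffOn))
  have hΦa : HasFDerivAt Φ (L : E →L[ℝ] E) a := by
    have hGd : HasFDerivAt G (fderiv ℝ G a) a :=
      ((hG.contDiffAt (hU.mem_nhds ha)).differentiableAt (by simp)).hasFDerivAt
    convert! L.hasFDerivAt.add
      (S'.hasFDerivAt.comp a (hGd.sub (fderiv ℝ G a).hasFDerivAt)) using 1
    simp
  obtain ⟨R, hR, haR, hRU, hRsymm⟩ := exists_openPartialHomeomorph_of_contDiffOn hU hΦ ha hΦa
  refine ⟨R, haR, hRU, hR ▸ hΦ.mono hRU, hRsymm, fun y _ => ?_⟩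
  have hBS : B (S (G y - fderiv ℝ G a y)) = G y - fderiv ℝ G a y := LinearMap.congr_fun hS _
  rw [hR, map_add, hL]
  exact (congrArg _ hBS).trans (add_sub_cancel _ _)

end NormalForm

section AdaptedChart

variable {E : Type*} [NormedAddCommGroup E] [NormedSpace ℝ E]
  {M : Type*} [TopologicalSpace M] [ChartedSpace E M]
  {F : Type*} [NormedAddCommGroup F] [NormedSpace ℝ F]
  {N : Type*} [TopologicalSpace N] [ChartedSpace F N]

lemma exists_mem_maximalAtlas_convex_target [IsManifold 𝓘(ℝ, E) ∞ M]
    {φ : OpenPartialHomeomorph M E} (hφ : φ ∈ IsManifold.maximalAtlas 𝓘(ℝ, E) ∞ M) {p : M}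
    (hp : p ∈ φ.source) {U : Set M} (hU : U ∈ nhds p) :
    ∃ χ ∈ IsManifold.maximalAtlas 𝓘(ℝ, E) ∞ M, ⇑χ = φ ∧ p ∈ χ.source ∧
      χ.source ⊆ φ.source ∩ U ∧ Convex ℝ χ.target := by
  have hV : φ.target ∩ φ.symm ⁻¹' U ∈ nhds (φ p) := Filter.inter_mem
    (φ.open_target.mem_nhds (φ.map_source hp))
    ((φ.symm.continuousAt (φ.map_source hp)).preimage_mem_nhds (by rwa [φ.left_inv hp]))
  obtain ⟨ε, hε, hball⟩ := Metric.mem_nhds_iff.1 hV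
  let χ := (φ.symm.restrOpen _ (Metric.isOpen_ball (x := φ p) (ε := ε))).symm
  have htarget : χ.target = φ.target ∩ Metric.ball (φ p) ε := rfl
  refine ⟨χ, χ.mem_maximalAtlas_of_contMDiffOn
    ((contMDiffOn_of_mem_maximalAtlas hφ).mono fun x hx => hx.1)
    ((contMDiffOn_symm_of_mem_maximalAtlas hφ).mono fun x hx => hx.1), rfl,
    ⟨hp, Metric.mem_ball_self hε⟩, fun x hx => ⟨hx.1, ?_⟩, ?_⟩
  · simpa [φ.left_inv hx.1] using (hball hx.2).2
  · rw [htarget, Set.inter_eq_right.2 fun y hy => (hball hy).1]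
    exact convex_ball _ _

lemma surjective_fderiv_comp_symm {φ : OpenPartialHomeomorph M E}
    (hφ : φ ∈ IsManifold.maximalAtlas 𝓘(ℝ, E) ∞ M) {p : M} (hp : p ∈ φ.source)
    {ψ : OpenPartialHomeomorph N F} (hψ : ψ ∈ IsManifold.maximalAtlas 𝓘(ℝ, F) ∞ N) {f : M → N}
    (hfp : f p ∈ ψ.source) (hf : MDifferentiableAt 𝓘(ℝ, E) 𝓘(ℝ, F) f p)
    (hsurj : Function.Surjective (mfderiv 𝓘(ℝ, E) 𝓘(ℝ, F) f p)) :
    Function.Surjective (fderiv ℝ ((ψ ∘ f) ∘ φ.symm) (φ p)) := by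
  have hψ' := mdifferentiable_of_mem_maximalAtlas hψ
  have hψf : MDifferentiableAt 𝓘(ℝ, E) 𝓘(ℝ, F) (ψ ∘ f) p :=
    (hψ'.mdifferentiableAt hfp).comp p hf
  intro w
  obtain ⟨v, hv⟩ := (hψ'.mfderiv_surjective hfp).comp hsurj w
  have hchain : mvfderiv 𝓘(ℝ, E) (ψ ∘ f) p v = w :=
    (mfderiv_comp_apply p (hψ'.mdifferentiableAt hfp) hf v).trans hv
  exact ⟨_, (mvfderiv_eq_fderiv_mvfderiv hφ hp hψf v).symm.trans hchain⟩

/-- Charts `φ` of `M` and `ψ` of `N`, the first one with convex image, in which the map `f` becomes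
the linear map `B`. -/
structure IsAdaptedChart (B : E →L[ℝ] F) (f : M → N) (φ : OpenPartialHomeomorph M E)
    (ψ : OpenPartialHomeomorph N F) : Prop where
  mem_maximalAtlas : φ ∈ IsManifold.maximalAtlas 𝓘(ℝ, E) ∞ M
  mem_maximalAtlas_base : ψ ∈ IsManifold.maximalAtlas 𝓘(ℝ, F) ∞ N
  convex_target : Convex ℝ φ.target
  mapsTo : Set.MapsTo f φ.source ψ.source
  apply_eq : ∀ x ∈ φ.source, ψ (f x) = B (φ x)

lemma exists_isAdaptedChart [FiniteDimensional ℝ E] [IsManifold 𝓘(ℝ, E) ∞ M]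
    [IsManifold 𝓘(ℝ, F) ∞ N] {B : E →L[ℝ] F} (hB : Function.Surjective B) {f : M → N}
    (hf : ContMDiff 𝓘(ℝ, E) 𝓘(ℝ, F) ∞ f) {p : M}
    (hp : Function.Surjective (mfderiv 𝓘(ℝ, E) 𝓘(ℝ, F) f p)) {U : Set M} (hU : U ∈ nhds p) :
    ∃ φ ψ, IsAdaptedChart B f φ ψ ∧ p ∈ φ.source ∧ φ.source ⊆ U := by
  set φ₀ := chartAt E p
  set ψ := chartAt F (f p)
  have hφ₀ : φ₀ ∈ IsManifold.maximalAtlas 𝓘(ℝ, E) ∞ M := IsManifold.chart_mem_maximalAtlas p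
  have hψ : ψ ∈ IsManifold.maximalAtlas 𝓘(ℝ, F) ∞ N := IsManifold.chart_mem_maximalAtlas (f p)
  have hpφ₀ : p ∈ φ₀.source := mem_chart_source _ p
  have hfp : f p ∈ ψ.source := mem_chart_source _ (f p)
  have hψf {x : M} (hx : f x ∈ ψ.source) : ContMDiffAt 𝓘(ℝ, E) 𝓘(ℝ, F) ∞ (ψ ∘ f) x :=
    (contMDiffAt_of_mem_maximalAtlas hψ hx).comp x (hf x)
  obtain ⟨R, hpR, hRU, hR, hRsymm, hRG⟩ := exists_openPartialHomeomorph_linearizing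
    (φ₀.isOpen_inter_preimage_symm (ψ.open_source.preimage hf.continuous))
    (fun y hy => (by
      simpa [φ₀.right_inv hy.1] using contDiffAt_comp_symm hφ₀ (φ₀.map_target hy.1)
        (hψf hy.2) : ContDiffAt ℝ ∞ ((ψ ∘ f) ∘ φ₀.symm) y).contDiffWithinAt)
    ⟨φ₀.map_source hpφ₀, by simpa [φ₀.left_inv hpφ₀] using hfp⟩
    (surjective_fderiv_comp_symm hφ₀ hpφ₀ hψ hfp (hf.mdifferentiableAt (by simp)) hp) hB
  have hχ : φ₀.trans R ∈ IsManifold.maximalAtlas 𝓘(ℝ, E) ∞ M := by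
    refine OpenPartialHomeomorph.mem_maximalAtlas_of_contMDiffOn _ ?_ ?_
    · exact hR.contMDiffOn.comp' (contMDiffOn_of_mem_maximalAtlas hφ₀)
    · exact (contMDiffOn_symm_of_mem_maximalAtlas hφ₀).comp' hRsymm.contMDiffOn
  obtain ⟨φ, hφ, hφχ, hpφ, hφU, hconvex⟩ :=
    exists_mem_maximalAtlas_convex_target hχ (by simp [hpφ₀, hpR] : p ∈ (φ₀.trans R).source) hU
  refine ⟨φ, ψ, ⟨hφ, hψ, hconvex, fun x hx => ?_, fun x hx => ?_⟩, hpφ, fun x hx => (hφU hx).2⟩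
  · have hx' := (φ₀.trans_source R).subset (hφU hx).1
    simpa [φ₀.left_inv hx'.1] using (hRU hx'.2).2
  · have hx' := (φ₀.trans_source R).subset (hφU hx).1
    simpa [hφχ, φ₀.left_inv hx'.1] using (hRG _ hx'.2).symm

namespace IsAdaptedChart

variable {B : E →L[ℝ] F} {f : M → N} {φ : OpenPartialHomeomorph M E}
  {ψ : OpenPartialHomeomorph N F} (hc : IsAdaptedChart B f φ ψ) {x : M} (hx : x ∈ φ.source)
  (hf : MDifferentiableAt 𝓘(ℝ, E) 𝓘(ℝ, F) f x)

include hc hx hf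

lemma mvfderiv_mfderiv (v : TangentSpace 𝓘(ℝ, E) x) :
    mvfderiv 𝓘(ℝ, F) ψ (f x) (mfderiv 𝓘(ℝ, E) 𝓘(ℝ, F) f x v) = B (mvfderiv 𝓘(ℝ, E) φ x v) := by
  have hψ := (mdifferentiable_of_mem_maximalAtlas hc.mem_maximalAtlas_base).mdifferentiableAt
    (hc.mapsTo hx)
  have hφ := (mdifferentiable_of_mem_maximalAtlas hc.mem_maximalAtlas).mdifferentiableAt hx
  have heq : (ψ ∘ f) =ᶠ[nhds x] (B ∘ φ) := by
    filter_upwards [φ.open_source.mem_nhds hx] with z hz using hc.apply_eq z hz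
  calc mvfderiv 𝓘(ℝ, F) ψ (f x) (mfderiv 𝓘(ℝ, E) 𝓘(ℝ, F) f x v)
      = mvfderiv 𝓘(ℝ, E) (ψ ∘ f) x v := (mfderiv_comp_apply x hψ hf v).symm
    _ = mvfderiv 𝓘(ℝ, E) (B ∘ φ) x v := DFunLike.congr_fun heq.mfderiv_eq v
    _ = B (mvfderiv 𝓘(ℝ, E) φ x v) := DFunLike.congr_fun (mvfderiv_clm_comp B hφ) v

lemma mfderiv_eq_zero_iff (v : TangentSpace 𝓘(ℝ, E) x) :
    mfderiv 𝓘(ℝ, E) 𝓘(ℝ, F) f x v = 0 ↔ B (mvfderiv 𝓘(ℝ, E) φ x v) = 0 := by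
  rw [← hc.mvfderiv_mfderiv hx hf v]
  exact (((mdifferentiable_of_mem_maximalAtlas hc.mem_maximalAtlas_base).mfderiv
    (hc.mapsTo hx)).map_eq_zero_iff).symm

lemma surjective_mfderiv (hB : Function.Surjective B) :
    Function.Surjective (mfderiv 𝓘(ℝ, E) 𝓘(ℝ, F) f x) := by
  have hφ := mdifferentiable_of_mem_maximalAtlas hc.mem_maximalAtlas
  have hψ := mdifferentiable_of_mem_maximalAtlas hc.mem_maximalAtlas_base
  refine .of_comp_left (f := mvfderiv 𝓘(ℝ, F) ψ (f x)) ?_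
    (hψ.mfderiv_injective (hc.mapsTo hx))
  convert hB.comp (hφ.mfderiv_surjective hx) using 1
  exact funext (hc.mvfderiv_mfderiv hx hf)

end IsAdaptedChart

end AdaptedChart

section PlanarBracket

variable {E : Type*} [NormedAddCommGroup E] [NormedSpace ℝ E]
  {M : Type*} [TopologicalSpace M] [ChartedSpace E M] {φ : OpenPartialHomeomorph M E} {x : M}

lemma coordDeriv_sub {g h : M → ℝ} (hg : MDifferentiableAt 𝓘(ℝ, E) 𝓘(ℝ, ℝ) g x)
    (hh : MDifferentiableAt 𝓘(ℝ, E) 𝓘(ℝ, ℝ) h x) (v : E) :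
    coordDeriv φ v (g - h) x = coordDeriv φ v g x - coordDeriv φ v h x := by
  rw [coordDeriv, mvfderiv_sub hg hh]
  rfl

lemma coordDeriv_mul {g h : M → ℝ} (hg : MDifferentiableAt 𝓘(ℝ, E) 𝓘(ℝ, ℝ) g x)
    (hh : MDifferentiableAt 𝓘(ℝ, E) 𝓘(ℝ, ℝ) h x) (v : E) :
    coordDeriv φ v (g * h) x = g x * coordDeriv φ v h x + h x * coordDeriv φ v g x := by
  rw [coordDeriv, mvfderiv_mul hg hh]
  rfl

/-- The bracket `c ∂_u ∧ ∂_v`, for the coordinate vector fields of the chart `φ` in the directions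
`u` and `v`. -/
def planarBracket (φ : OpenPartialHomeomorph M E) (u v : E) (c g h : M → ℝ) : M → ℝ :=
  c * (coordDeriv φ u g * coordDeriv φ v h - coordDeriv φ v g * coordDeriv φ u h)

lemma planarBracket_congr_right {c g h l : M → ℝ} (hhl : h =ᶠ[nhds x] l) (u v : E) :
    planarBracket φ u v c g h x = planarBracket φ u v c g l x := by
  have hderiv (w : E) : coordDeriv φ w h x = coordDeriv φ w l x :=
    DFunLike.congr_fun hhl.mfderiv_eq (coordField φ w x)
  simp only [planarBracket, Pi.mul_apply, Pi.sub_apply, hderiv]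

variable [IsManifold 𝓘(ℝ, E) ∞ M] (hφ : φ ∈ IsManifold.maximalAtlas 𝓘(ℝ, E) ∞ M)
  (hx : x ∈ φ.source) {c g h l : M → ℝ} (hc : ContMDiffAt 𝓘(ℝ, E) 𝓘(ℝ, ℝ) ∞ c x)
  (hg : ContMDiffAt 𝓘(ℝ, E) 𝓘(ℝ, ℝ) ∞ g x) (hh : ContMDiffAt 𝓘(ℝ, E) 𝓘(ℝ, ℝ) ∞ h x)
  (hl : ContMDiffAt 𝓘(ℝ, E) 𝓘(ℝ, ℝ) ∞ l x)

include hφ hx hc hg hh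

lemma coordDeriv_planarBracket (u v w : E) :
    coordDeriv φ w (planarBracket φ u v c g h) x =
      c x * (coordDeriv φ w (coordDeriv φ u g) x * coordDeriv φ v h x +
          coordDeriv φ u g x * coordDeriv φ w (coordDeriv φ v h) x -
          coordDeriv φ w (coordDeriv φ v g) x * coordDeriv φ u h x -
          coordDeriv φ v g x * coordDeriv φ w (coordDeriv φ u h) x) +
        (coordDeriv φ u g x * coordDeriv φ v h x - coordDeriv φ v g x * coordDeriv φ u h x) *
          coordDeriv φ w c x := by
  have hdiff {g : M → ℝ} (hg : ContMDiffAt 𝓘(ℝ, E) 𝓘(ℝ, ℝ) ∞ g x) (u : E) :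
      MDifferentiableAt 𝓘(ℝ, E) 𝓘(ℝ, ℝ) (coordDeriv φ u g) x :=
    (contMDiffAt_coordDeriv hφ hx hg u).mdifferentiableAt (by simp)
  have h₁ := (hdiff hg u).mul (hdiff hh v)
  have h₂ := (hdiff hg v).mul (hdiff hh u)
  rw [planarBracket, coordDeriv_mul (hc.mdifferentiableAt (by simp)) (h₁.sub h₂),
    coordDeriv_sub h₁ h₂, coordDeriv_mul (hdiff hg u) (hdiff hh v),
    coordDeriv_mul (hdiff hg v) (hdiff hh u)]
  simp only [Pi.sub_apply, Pi.mul_apply]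
  ring

include hl

lemma planarBracket_jacobi (u v : E) :
    planarBracket φ u v c g (planarBracket φ u v c h l) x +
      planarBracket φ u v c h (planarBracket φ u v c l g) x +
      planarBracket φ u v c l (planarBracket φ u v c g h) x = 0 := by
  have hexpand (a b : M → ℝ) : planarBracket φ u v c a b x =
      c x * (coordDeriv φ u a x * coordDeriv φ v b x - coordDeriv φ v a x * coordDeriv φ u b x) :=
    rfl
  simp only [hexpand _ (planarBracket _ _ _ _ _ _), coordDeriv_planarBracket hφ hx hc hh hl,
    coordDeriv_planarBracket hφ hx hc hl hg, coordDeriv_planarBracket hφ hx hc hg hh,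
    coordDeriv_comm hφ hx hg u v, coordDeriv_comm hφ hx hh u v, coordDeriv_comm hφ hx hl u v]
  ring

end PlanarBracket

section TailProj

/-- The projection of `ℝ^(m + 2)` that forgets the first two coordinates. -/
def tailProj (m : ℕ) : EuclideanSpace ℝ (Fin (m + 2)) →L[ℝ] EuclideanSpace ℝ (Fin m) :=
  LinearMap.toContinuousLinearMap
    { toFun := fun v => WithLp.toLp 2 fun i => v i.succ.succ
      map_add' := fun _ _ => rfl
      map_smul' := fun _ _ => rfl }

variable {m : ℕ}

lemma tailProj_apply (v : EuclideanSpace ℝ (Fin (m + 2))) (i : Fin m) :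
    tailProj m v i = v i.succ.succ :=
  rfl

lemma tailProj_surjective : Function.Surjective (tailProj m) := fun w =>
  ⟨WithLp.toLp 2 (Fin.cons 0 (Fin.cons 0 w)), rfl⟩

lemma finrank_ker_tailProj : Module.finrank ℝ (LinearMap.ker (tailProj m).toLinearMap) = 2 := by
  have h := (tailProj m).toLinearMap.finrank_range_add_finrank_ker
  rw [LinearMap.range_eq_top.2 tailProj_surjective, finrank_top, finrank_euclideanSpace_fin,
    finrank_euclideanSpace_fin] at h
  omega

lemma tailProj_eq_zero_iff {v : EuclideanSpace ℝ (Fin (m + 2))} :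
    tailProj m v = 0 ↔ v = v 0 • EuclideanSpace.single 0 1 + v 1 • EuclideanSpace.single 1 1 := by
  constructor
  · intro h
    ext i
    refine Fin.cases (by simp) (Fin.cases (by simp) fun j => ?_) i
    have hj : v j.succ.succ = 0 := congr($h j)
    simp [hj, Fin.succ_succ_ne_one]
  · intro h
    ext j
    rw [tailProj_apply, h]
    simp [Fin.succ_succ_ne_one]

lemma tailProj_single_succ_succ (i : Fin m) :
    tailProj m (EuclideanSpace.single i.succ.succ 1) = EuclideanSpace.single i 1 := by
  ext j
  simp [tailProj_apply]

end TailProj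

section StdField

variable {n : ℕ} {M : Type*} [TopologicalSpace M] [ChartedSpace (EuclideanSpace ℝ (Fin n)) M]
  {φ : OpenPartialHomeomorph M (EuclideanSpace ℝ (Fin n))} {x : M}

/-- The coordinate vector field of the chart `φ` belonging to the `i`-th coordinate. -/
def stdField (φ : OpenPartialHomeomorph M (EuclideanSpace ℝ (Fin n))) (i : Fin n) (x : M) :
    TangentSpace (𝓡 n) x :=
  coordField φ (EuclideanSpace.single i 1) x

lemma exists_basis_stdField (hφ : φ ∈ IsManifold.maximalAtlas (𝓡 n) ∞ M) (hx : x ∈ φ.source) :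
    ∃ b : Module.Basis (Fin n) ℝ (TangentSpace (𝓡 n) x), ⇑b = fun i => stdField φ i x := by
  obtain ⟨b, hb⟩ := exists_basis_coordField hφ hx (EuclideanSpace.basisFun (Fin n) ℝ).toBasis
  exact ⟨b, funext fun i => by simp [hb, stdField]⟩

lemma mvfderiv_coordinate (hφ : φ ∈ IsManifold.maximalAtlas (𝓡 n) ∞ M) (hx : x ∈ φ.source)
    (i : Fin n) :
    mvfderiv (𝓡 n) (fun y => φ y i) x =
      (EuclideanSpace.proj i : EuclideanSpace ℝ (Fin n) →L[ℝ] ℝ) ∘L mvfderiv (𝓡 n) φ x :=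
  mvfderiv_clm_comp (EuclideanSpace.proj i)
    ((mdifferentiable_of_mem_maximalAtlas hφ).mdifferentiableAt hx)

lemma contMDiffAt_coordinate
    (hφ : φ ∈ IsManifold.maximalAtlas (𝓡 n) ∞ M) (hx : x ∈ φ.source) (i : Fin n) :
    ContMDiffAt (𝓡 n) 𝓘(ℝ, ℝ) ∞ (fun y => φ y i) x :=
  (EuclideanSpace.proj (𝕜 := ℝ) i : EuclideanSpace ℝ (Fin n) →L[ℝ] ℝ).contDiff.contMDiff
    |>.contMDiffAt.comp x (contMDiffAt_of_mem_maximalAtlas hφ hx)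

end StdField

section PlanarForm

variable {m : ℕ} {M : Type*} [TopologicalSpace M]
  [ChartedSpace (EuclideanSpace ℝ (Fin (m + 2))) M]
  {N : Type*} [TopologicalSpace N] [ChartedSpace (EuclideanSpace ℝ (Fin m)) N]
  (μ : VolumeForm (m + 2) M) (Ω : VolumeForm m N)
  (f : C^∞⟮𝓡 (m + 2), M; 𝓡 m, N⟯) (k : C^∞⟮𝓡 (m + 2), M; ℝ⟯)

/-- The bracket of the first two coordinates of the chart `φ`. -/
def planarCoeff (φ : OpenPartialHomeomorph M (EuclideanSpace ℝ (Fin (m + 2)))) (x : M) : ℝ :=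
  jacobianBivector μ Ω f k x (mvfderiv (𝓡 (m + 2)) (fun y => φ y 0) x)
    (mvfderiv (𝓡 (m + 2)) (fun y => φ y 1) x)

variable {μ Ω f k} {φ : OpenPartialHomeomorph M (EuclideanSpace ℝ (Fin (m + 2)))}
  {ψ : OpenPartialHomeomorph N (EuclideanSpace ℝ (Fin m))} {x : M}

lemma contMDiffAt_planarCoeff [IsManifold (𝓡 (m + 2)) ∞ M] [IsManifold (𝓡 m) ∞ N]
    (hφ : φ ∈ IsManifold.maximalAtlas (𝓡 (m + 2)) ∞ M) (hx : x ∈ φ.source) :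
    ContMDiffAt (𝓡 (m + 2)) 𝓘(ℝ, ℝ) ∞ (planarCoeff μ Ω f k φ) x :=
  contMDiffAt_jacobianBivector (contMDiffAt_coordinate hφ hx 0) (contMDiffAt_coordinate hφ hx 1)

namespace IsAdaptedChart

variable (hc : IsAdaptedChart (tailProj m) f φ ψ) (hx : x ∈ φ.source)

include hc hx

lemma eq_smul_add_smul {v : TangentSpace (𝓡 (m + 2)) x}
    (hv : tailProj m (mvfderiv (𝓡 (m + 2)) φ x v) = 0) :
    v = mvfderiv (𝓡 (m + 2)) φ x v 0 • stdField φ 0 x +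
      mvfderiv (𝓡 (m + 2)) φ x v 1 • stdField φ 1 x := by
  conv_lhs => rw [← coordField_mvfderiv hc.mem_maximalAtlas hx v, tailProj_eq_zero_iff.1 hv]
  simp only [stdField, coordField_add, coordField_smul]

lemma exists_covector_eq (α : TangentSpace (𝓡 (m + 2)) x →ₗ[ℝ] ℝ) :
    ∃ κ : TangentSpace (𝓡 m) (f x) →ₗ[ℝ] ℝ,
      α = α (stdField φ 0 x) • (mvfderiv (𝓡 (m + 2)) (fun y => φ y 0) x).toLinearMap +
        α (stdField φ 1 x) • (mvfderiv (𝓡 (m + 2)) (fun y => φ y 1) x).toLinearMap +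
        κ ∘ₗ (mfderiv (𝓡 (m + 2)) (𝓡 m) f x).toLinearMap := by
  set θ := α (stdField φ 0 x) • (mvfderiv (𝓡 (m + 2)) (fun y => φ y 0) x).toLinearMap +
    α (stdField φ 1 x) • (mvfderiv (𝓡 (m + 2)) (fun y => φ y 1) x).toLinearMap
  suffices α - θ ∈ LinearMap.range (mfderiv (𝓡 (m + 2)) (𝓡 m) f x).toLinearMap.dualMap by
    obtain ⟨κ, hκ⟩ := this
    exact ⟨κ, (add_eq_of_eq_sub' hκ).symm⟩
  rw [LinearMap.range_dualMap_eq_dualAnnihilator_ker, Submodule.mem_dualAnnihilator]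
  intro v hv
  have hdecomp := hc.eq_smul_add_smul hx
    ((hc.mfderiv_eq_zero_iff hx (f.contMDiff.mdifferentiable (by simp) x) v).1 hv)
  have hα := congr(α $hdecomp)
  simp only [map_add, map_smul, smul_eq_mul] at hα
  simp only [θ, mvfderiv_coordinate hc.mem_maximalAtlas hx, LinearMap.sub_apply,
    LinearMap.add_apply, LinearMap.smul_apply, ContinuousLinearMap.coe_coe,
    ContinuousLinearMap.comp_apply, PiLp.proj_apply, smul_eq_mul, hα]
  ring

lemma jacobianBivector_eq (α β : TangentSpace (𝓡 (m + 2)) x →L[ℝ] ℝ) :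
    jacobianBivector μ Ω f k x α β = planarCoeff μ Ω f k φ x *
      (α (stdField φ 0 x) * β (stdField φ 1 x) - α (stdField φ 1 x) * β (stdField φ 0 x)) := by
  have h := wedgePullback_eq_smul (finrank_tangentSpace_euclidean (f x))
    (hc.exists_covector_eq hx) (Ω.toForm (f x)) α.toLinearMap β.toLinearMap
  simp only [ContinuousLinearMap.coe_coe] at h
  simp only [planarCoeff, jacobianBivector, wedgeWithPullback, LinearMap.mk₂_apply, h,
    AlternatingMap.smul_apply, smul_eq_mul]
  ring

lemma mfderiv_stdField_succ_succ (i : Fin m) :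
    mfderiv (𝓡 (m + 2)) (𝓡 m) f x (stdField φ i.succ.succ x) = stdField ψ i (f x) := by
  rw [← coordField_mvfderiv hc.mem_maximalAtlas_base (hc.mapsTo hx)
    (mfderiv (𝓡 (m + 2)) (𝓡 m) f x (stdField φ i.succ.succ x)),
    hc.mvfderiv_mfderiv hx (f.contMDiff.mdifferentiable (by simp) x), stdField,
    mvfderiv_coordField hc.mem_maximalAtlas hx, tailProj_single_succ_succ, stdField]

lemma planarCoeff_ne_zero (hk : k x ≠ 0) : planarCoeff μ Ω f k φ x ≠ 0 := by
  obtain ⟨b, hb⟩ := exists_basis_stdField hc.mem_maximalAtlas hx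
  obtain ⟨b', hb'⟩ := exists_basis_stdField hc.mem_maximalAtlas_base (hc.mapsTo hx)
  have hθ (i j : Fin (m + 2)) : mvfderiv (𝓡 (m + 2)) (fun y => φ y i) x (stdField φ j x) =
      if i = j then 1 else 0 := by
    rw [mvfderiv_coordinate hc.mem_maximalAtlas hx, ContinuousLinearMap.comp_apply, stdField,
      mvfderiv_coordField hc.mem_maximalAtlas hx]
    simp
  have hframe : ⇑b = Fin.cons (stdField φ 0 x) (Fin.cons (stdField φ 1 x)
      fun i : Fin m => stdField φ i.succ.succ x : Fin (m + 1) → _) := by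
    rw [hb]
    exact funext (Fin.cases rfl (Fin.cases rfl fun i => rfl))
  have hwedge : wedgeWithPullback Ω f x (mvfderiv (𝓡 (m + 2)) (fun y => φ y 0) x)
      (mvfderiv (𝓡 (m + 2)) (fun y => φ y 1) x) b = Ω.toForm (f x) b' := by
    rw [wedgeWithPullback, hframe, wedgePullback_cons_cons]
    · rw [hb', ← funext (hc.mfderiv_stdField_succ_succ hx)]
      simp [hθ, Function.comp_def]
    · simp [hθ]
    · simp [hθ, Fin.succ_ne_zero, eq_comm]
    · simp [hθ, Fin.succ_succ_ne_one, eq_comm]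
  have hπ := jacobianBivector_mul_apply (μ := μ) (Ω := Ω) (f := f) (k := k) x
    (mvfderiv (𝓡 (m + 2)) (fun y => φ y 0) x) (mvfderiv (𝓡 (m + 2)) (fun y => φ y 1) x) b
  rw [hwedge] at hπ
  exact left_ne_zero_of_mul (hπ.trans_ne (mul_ne_zero hk (Ω.apply_basis_ne_zero b')))

end IsAdaptedChart

end PlanarForm

section Covectors

variable {E : Type*} [NormedAddCommGroup E] [NormedSpace ℝ E] [FiniteDimensional ℝ E]
  {M : Type*} [TopologicalSpace M] [ChartedSpace E M] {x : M}

lemma exists_mvfderiv_eq [T2Space M] [IsManifold 𝓘(ℝ, E) ∞ M]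
    (α : TangentSpace 𝓘(ℝ, E) x →L[ℝ] ℝ) :
    ∃ h : C^∞⟮𝓘(ℝ, E), M; ℝ⟯, mvfderiv 𝓘(ℝ, E) h x = α := by
  set φ := chartAt E x
  have hφ : φ ∈ IsManifold.maximalAtlas 𝓘(ℝ, E) ∞ M := IsManifold.chart_mem_maximalAtlas x
  have hx : x ∈ φ.source := mem_chart_source _ x
  let κ : E →L[ℝ] ℝ := α ∘L mfderiv 𝓘(ℝ, E) 𝓘(ℝ, E) φ.symm (φ x)
  obtain ⟨χ⟩ : Nonempty (SmoothBumpFunction 𝓘(ℝ, E) x) := inferInstance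
  refine ⟨⟨fun z => χ z • (κ ∘ φ) z, χ.contMDiff_smul
    (κ.contDiff.contMDiff.comp_contMDiffOn (contMDiffOn_of_mem_maximalAtlas hφ))⟩, ?_⟩
  have hlocal : (fun z => χ z • (κ ∘ φ) z) =ᶠ[nhds x] κ ∘ φ := by
    filter_upwards [χ.eventuallyEq_one] with z hz
    simp [hz]
  ext v
  have hchain : mvfderiv 𝓘(ℝ, E) (κ ∘ φ) x v = κ (mvfderiv 𝓘(ℝ, E) φ x v) :=
    DFunLike.congr_fun (mvfderiv_clm_comp κ
      ((mdifferentiable_of_mem_maximalAtlas hφ).mdifferentiableAt hx)) v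
  calc mvfderiv 𝓘(ℝ, E) (fun z => χ z • (κ ∘ φ) z) x v
      = mvfderiv 𝓘(ℝ, E) (κ ∘ φ) x v := DFunLike.congr_fun hlocal.mfderiv_eq v
    _ = κ (mvfderiv 𝓘(ℝ, E) φ x v) := hchain
    _ = α v := congrArg α (coordField_mvfderiv hφ hx v)

lemma eq_of_forall_covector_eq {v w : TangentSpace 𝓘(ℝ, E) x}
    (h : ∀ β : TangentSpace 𝓘(ℝ, E) x →L[ℝ] ℝ, β v = β w) : v = w :=
  (Module.evalEquiv ℝ _).injective (LinearMap.ext fun β => h (LinearMap.toContinuousLinearMap β))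

end Covectors

section Derivations

variable {E : Type*} [NormedAddCommGroup E] [NormedSpace ℝ E]
  {M : Type*} [TopologicalSpace M] [ChartedSpace E M] {x : M}

lemma mvfderiv_coe_add (g h : C^∞⟮𝓘(ℝ, E), M; ℝ⟯) :
    mvfderiv 𝓘(ℝ, E) (⇑g + ⇑h) x = mvfderiv 𝓘(ℝ, E) g x + mvfderiv 𝓘(ℝ, E) h x :=
  mvfderiv_add (g.contMDiff.mdifferentiable (by simp) x) (h.contMDiff.mdifferentiable (by simp) x)

lemma mvfderiv_coe_mul (g h : C^∞⟮𝓘(ℝ, E), M; ℝ⟯) :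
    mvfderiv 𝓘(ℝ, E) (⇑g * ⇑h) x = g x • mvfderiv 𝓘(ℝ, E) h x + h x • mvfderiv 𝓘(ℝ, E) g x :=
  mvfderiv_mul (g.contMDiff.mdifferentiable (by simp) x) (h.contMDiff.mdifferentiable (by simp) x)

lemma mvfderiv_coe_smul (c : ℝ) (g : C^∞⟮𝓘(ℝ, E), M; ℝ⟯) :
    mvfderiv 𝓘(ℝ, E) (c • ⇑g) x = c • mvfderiv 𝓘(ℝ, E) g x :=
  const_smul_mfderiv (g.contMDiff.mdifferentiable (by simp) x) c

end Derivations

section Poisson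

variable {m : ℕ} {M : Type*} [TopologicalSpace M]
  [ChartedSpace (EuclideanSpace ℝ (Fin (m + 2))) M]
  {N : Type*} [TopologicalSpace N] [ChartedSpace (EuclideanSpace ℝ (Fin m)) N]
  [IsManifold (𝓡 (m + 2)) ∞ M] [IsManifold (𝓡 m) ∞ N]
  {μ : VolumeForm (m + 2) M} {Ω : VolumeForm m N}
  {f : C^∞⟮𝓡 (m + 2), M; 𝓡 m, N⟯} {k : C^∞⟮𝓡 (m + 2), M; ℝ⟯} {x : M}
  {φ : OpenPartialHomeomorph M (EuclideanSpace ℝ (Fin (m + 2)))}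
  {ψ : OpenPartialHomeomorph N (EuclideanSpace ℝ (Fin m))}

lemma exists_isAdaptedChart_of_notMem_degeneracyLocus (hx : x ∉ degeneracyLocus f k) :
    ∃ φ ψ, IsAdaptedChart (tailProj m) f φ ψ ∧ x ∈ φ.source ∧
      Disjoint φ.source (degeneracyLocus f k) := by
  have hx : Function.Surjective (mfderiv (𝓡 (m + 2)) (𝓡 m) f x) ∧ k x ≠ 0 := by
    simpa only [degeneracyLocus, criticalSet, Set.mem_union, Set.mem_ofPred_eq, not_or, not_not]
      using hx
  obtain ⟨φ, ψ, hc, hxφ, hφk⟩ := exists_isAdaptedChart tailProj_surjective f.contMDiff hx.1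
    (k.contMDiff.continuous.continuousAt.eventually_ne hx.2)
  refine ⟨φ, ψ, hc, hxφ, Set.disjoint_left.2 fun y hy => not_or.2 ⟨not_not.2 ?_, hφk hy⟩⟩
  exact hc.surjective_mfderiv hy (f.contMDiff.mdifferentiable (by simp) y) tailProj_surjective

lemma IsAdaptedChart.jacobianBracket_eventuallyEq (hc : IsAdaptedChart (tailProj m) f φ ψ)
    (hx : x ∈ φ.source) (g h : C^∞⟮𝓡 (m + 2), M; ℝ⟯) :
    jacobianBracket μ Ω f k g h =ᶠ[nhds x] planarBracket φ (EuclideanSpace.single 0 1)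
      (EuclideanSpace.single 1 1) (planarCoeff μ Ω f k φ) g h := by
  filter_upwards [φ.open_source.mem_nhds hx] with y hy using hc.jacobianBivector_eq hy _ _

lemma jacobianBracket_jacobi (g h l : C^∞⟮𝓡 (m + 2), M; ℝ⟯) :
    jacobianBracket μ Ω f k g (jacobianBracket μ Ω f k h l) +
      jacobianBracket μ Ω f k h (jacobianBracket μ Ω f k l g) +
      jacobianBracket μ Ω f k l (jacobianBracket μ Ω f k g h) = 0 := by
  ext x
  by_cases hx : x ∈ degeneracyLocus f k
  · simp [jacobianBracket_apply, jacobianBivector_eq_zero hx]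
  obtain ⟨φ, ψ, hc, hxφ, -⟩ := exists_isAdaptedChart_of_notMem_degeneracyLocus hx
  have hnested (a b d : C^∞⟮𝓡 (m + 2), M; ℝ⟯) :
      jacobianBracket μ Ω f k a (jacobianBracket μ Ω f k b d) x =
        planarBracket φ (EuclideanSpace.single 0 1) (EuclideanSpace.single 1 1)
          (planarCoeff μ Ω f k φ) a (planarBracket φ (EuclideanSpace.single 0 1)
            (EuclideanSpace.single 1 1) (planarCoeff μ Ω f k φ) b d) x :=
    (hc.jacobianBracket_eventuallyEq hxφ _ _).eq_of_nhds.trans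
      (planarBracket_congr_right (hc.jacobianBracket_eventuallyEq hxφ b d) _ _)
  simp only [ContMDiffMap.coe_add, Pi.add_apply, hnested]
  exact planarBracket_jacobi hc.mem_maximalAtlas hxφ
    (contMDiffAt_planarCoeff hc.mem_maximalAtlas hxφ) (g.contMDiff x) (h.contMDiff x)
    (l.contMDiff x) _ _

variable (μ Ω f k) in
/-- The Poisson bracket with `{g, h} μ = k dg ∧ dh ∧ f^*Ω`. -/
def jacobianPoisson : PoissonBracket (m + 2) M where
  bracket := LinearMap.mk₂ ℝ (jacobianBracket μ Ω f k)
    (fun g h l => by ext x; simp [jacobianBracket_apply, mvfderiv_coe_add])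
    (fun c g h => by ext x; simp [jacobianBracket_apply, mvfderiv_coe_smul])
    (fun g h l => by ext x; simp [jacobianBracket_apply, mvfderiv_coe_add])
    (fun c g h => by ext x; simp [jacobianBracket_apply, mvfderiv_coe_smul])
  bracket_self g := by ext x; exact jacobianBivector_self x _
  jacobi := jacobianBracket_jacobi
  leibniz_left g h l := by ext x; simp [jacobianBracket_apply, mvfderiv_coe_mul]
  leibniz_right g h l := by ext x; simp [jacobianBracket_apply, mvfderiv_coe_mul]

end Poisson

section Anchor

variable {m : ℕ} {M : Type*} [TopologicalSpace M]
  [ChartedSpace (EuclideanSpace ℝ (Fin (m + 2))) M]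
  {N : Type*} [TopologicalSpace N] [ChartedSpace (EuclideanSpace ℝ (Fin m)) N]
  {μ : VolumeForm (m + 2) M} {Ω : VolumeForm m N}
  {f : C^∞⟮𝓡 (m + 2), M; 𝓡 m, N⟯} {k : C^∞⟮𝓡 (m + 2), M; ℝ⟯} {x : M}
  {φ : OpenPartialHomeomorph M (EuclideanSpace ℝ (Fin (m + 2)))}
  {ψ : OpenPartialHomeomorph N (EuclideanSpace ℝ (Fin m))}

variable (μ Ω f k) in
/-- The bundle map `α ↦ π(·, α)` from covectors to tangent vectors, where `π` is the bivector
`jacobianBivector`. -/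
def jacobianAnchor (x : M) :
    (TangentSpace (𝓡 (m + 2)) x →L[ℝ] ℝ) →ₗ[ℝ] TangentSpace (𝓡 (m + 2)) x :=
  (Module.evalEquiv ℝ _).symm.toLinearMap ∘ₗ
    LinearMap.toContinuousLinearMap.toLinearMap.dualMap ∘ₗ (jacobianBivector μ Ω f k x).flip

lemma apply_jacobianAnchor (α β : TangentSpace (𝓡 (m + 2)) x →L[ℝ] ℝ) :
    β (jacobianAnchor μ Ω f k x α) = jacobianBivector μ Ω f k x β α :=
  Module.apply_evalEquiv_symm_apply ℝ _ β.toLinearMap _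

lemma jacobianAnchor_eq_zero (hx : x ∈ degeneracyLocus f k) : jacobianAnchor μ Ω f k x = 0 := by
  ext1 α
  refine eq_of_forall_covector_eq fun β => ?_
  simp [apply_jacobianAnchor, jacobianBivector_eq_zero hx]

lemma mfderiv_jacobianAnchor (α : TangentSpace (𝓡 (m + 2)) x →L[ℝ] ℝ) :
    mfderiv (𝓡 (m + 2)) (𝓡 m) f x (jacobianAnchor μ Ω f k x α) = 0 := by
  refine eq_of_forall_covector_eq fun β => ?_
  have hskew : (jacobianBivector μ Ω f k x).IsAlt := jacobianBivector_self x
  rw [← ContinuousLinearMap.comp_apply, apply_jacobianAnchor, ← hskew.neg,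
    jacobianBivector_comp_mfderiv, neg_zero, map_zero]

lemma IsAdaptedChart.jacobianAnchor_eq (hc : IsAdaptedChart (tailProj m) f φ ψ)
    (hx : x ∈ φ.source) (α : TangentSpace (𝓡 (m + 2)) x →L[ℝ] ℝ) :
    jacobianAnchor μ Ω f k x α = planarCoeff μ Ω f k φ x •
      (α (stdField φ 1 x) • stdField φ 0 x - α (stdField φ 0 x) • stdField φ 1 x) := by
  refine eq_of_forall_covector_eq fun β => ?_
  rw [apply_jacobianAnchor, hc.jacobianBivector_eq hx]
  simp only [map_smul, map_sub, smul_eq_mul]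
  ring

variable [T2Space M] [IsManifold (𝓡 (m + 2)) ∞ M] [IsManifold (𝓡 m) ∞ N]

lemma jacobianPoisson_sharp_iff {α : TangentSpace (𝓡 (m + 2)) x →L[ℝ] ℝ}
    {v : TangentSpace (𝓡 (m + 2)) x} :
    (jacobianPoisson μ Ω f k).Sharp x α v ↔ v = jacobianAnchor μ Ω f k x α := by
  constructor
  · rintro ⟨h, rfl, hv⟩
    refine eq_of_forall_covector_eq fun β => ?_
    obtain ⟨g, rfl⟩ := exists_mvfderiv_eq β
    rw [apply_jacobianAnchor]
    exact hv g
  · rintro rfl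
    obtain ⟨h, rfl⟩ := exists_mvfderiv_eq α
    exact ⟨h, rfl, fun g => apply_jacobianAnchor _ _⟩

lemma charDist_jacobianPoisson :
    (jacobianPoisson μ Ω f k).charDist x = LinearMap.range (jacobianAnchor μ Ω f k x) := by
  ext v
  constructor
  · rintro ⟨h, hv⟩
    exact ⟨_, (jacobianPoisson_sharp_iff.1 hv).symm⟩
  · rintro ⟨α, rfl⟩
    obtain ⟨h, rfl⟩ := exists_mvfderiv_eq α
    exact ⟨h, jacobianPoisson_sharp_iff.2 rfl⟩

end Anchor

section Lines

variable {E : Type*} [NormedAddCommGroup E] [NormedSpace ℝ E]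
  {M : Type*} [TopologicalSpace M] [ChartedSpace E M]

lemma isMIntegralCurveOn_symm_line {φ : OpenPartialHomeomorph M E}
    (hφ : φ ∈ IsManifold.maximalAtlas 𝓘(ℝ, E) ∞ M) {X : ∀ x : M, TangentSpace 𝓘(ℝ, E) x}
    {z w : E} {s : Set ℝ} (hs : ∀ t ∈ s, z + t • w ∈ φ.target)
    (hX : ∀ t ∈ s, X (φ.symm (z + t • w)) = coordField φ w (φ.symm (z + t • w))) :
    IsMIntegralCurveOn (fun t => φ.symm (z + t • w)) X s := by
  intro t ht
  have hline : HasFDerivAt (fun t : ℝ => z + t • w) ((1 : ℝ →L[ℝ] ℝ).smulRight w) t :=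
    ((hasFDerivAt_id t).smul_const w).const_add z
  have hcomp := ((mdifferentiable_of_mem_maximalAtlas hφ).mdifferentiableAt_symm
    (hs t ht)).hasMFDerivAt.comp t hline.hasMFDerivAt
  refine (hcomp.congr_mfderiv ?_).hasMFDerivWithinAt
  rw [hX t ht, coordField, φ.right_inv (hs t ht)]
  refine ContinuousLinearMap.ext fun s : ℝ => ?_
  exact map_smul (mfderiv 𝓘(ℝ, E) 𝓘(ℝ, E) φ.symm (z + t • w)) s w

end Lines

section VanishingFactor

variable {E : Type*} [NormedAddCommGroup E] [NormedSpace ℝ E]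
  {M : Type*} [TopologicalSpace M] [ChartedSpace E M]
  {F : Type*} [NormedAddCommGroup F] [NormedSpace ℝ F]

lemma mvfderiv_mul_clm_sub {c : M → ℝ} {g : M → F} {x : M} (κ : F →L[ℝ] ℝ) {z : F}
    (hc : MDifferentiableAt 𝓘(ℝ, E) 𝓘(ℝ, ℝ) c x) (hg : MDifferentiableAt 𝓘(ℝ, E) 𝓘(ℝ, F) g x)
    (hx : κ (g x - z) = 0) :
    mvfderiv 𝓘(ℝ, E) (fun y => c y * κ (g y - z)) x = c x • (κ ∘L mvfderiv 𝓘(ℝ, E) g x) := by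
  have hsub : MDifferentiableAt 𝓘(ℝ, E) 𝓘(ℝ, F) (fun y => g y - z) x :=
    hg.sub mdifferentiableAt_const
  have hκ := mvfderiv_clm_comp κ hsub
  rw [mvfderiv_fun_sub hg mdifferentiableAt_const, mvfderiv_const, sub_zero] at hκ
  have hmul := mvfderiv_mul hc (κ.mdifferentiableAt.comp x hsub)
  rwa [hκ, Function.comp_apply, hx, zero_smul, add_zero] at hmul

end VanishingFactor

section HamiltonianStep

variable {m : ℕ}

/-- The covector `w₀ dx₁ - w₁ dx₀`, which the bracket of the first two coordinates turns into the
vector `w₀ ∂₀ + w₁ ∂₁`. -/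
def planarCovector (w : EuclideanSpace ℝ (Fin (m + 2))) : EuclideanSpace ℝ (Fin (m + 2)) →L[ℝ] ℝ :=
  w 0 • EuclideanSpace.proj 1 - w 1 • EuclideanSpace.proj 0

lemma planarCovector_apply (w z : EuclideanSpace ℝ (Fin (m + 2))) :
    planarCovector w z = w 0 * z 1 - w 1 * z 0 :=
  rfl

variable {M : Type*} [TopologicalSpace M]
  [ChartedSpace (EuclideanSpace ℝ (Fin (m + 2))) M]
  {N : Type*} [TopologicalSpace N] [ChartedSpace (EuclideanSpace ℝ (Fin m)) N]
  {μ : VolumeForm (m + 2) M} {Ω : VolumeForm m N}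
  {f : C^∞⟮𝓡 (m + 2), M; 𝓡 m, N⟯} {k : C^∞⟮𝓡 (m + 2), M; ℝ⟯} {x p q : M}
  {φ : OpenPartialHomeomorph M (EuclideanSpace ℝ (Fin (m + 2)))}
  {ψ : OpenPartialHomeomorph N (EuclideanSpace ℝ (Fin m))}
  {w : EuclideanSpace ℝ (Fin (m + 2))}

namespace IsAdaptedChart

variable (hc : IsAdaptedChart (tailProj m) f φ ψ)

include hc

lemma jacobianAnchor_planarCovector (hx : x ∈ φ.source) (hk : k x ≠ 0) (hw : tailProj m w = 0) :
    jacobianAnchor μ Ω f k x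
      ((planarCoeff μ Ω f k φ x)⁻¹ • (planarCovector w ∘L mvfderiv (𝓡 (m + 2)) φ x)) =
      coordField φ w x := by
  have hstd (i : Fin (m + 2)) :
      mvfderiv (𝓡 (m + 2)) φ x (stdField φ i x) = EuclideanSpace.single i 1 :=
    mvfderiv_coordField hc.mem_maximalAtlas hx _
  have hw' := mvfderiv_coordField hc.mem_maximalAtlas hx w
  rw [hc.jacobianAnchor_eq hx, hc.eq_smul_add_smul hx (v := coordField φ w x) (by rwa [hw']), hw']
  have hk := hc.planarCoeff_ne_zero (μ := μ) (Ω := Ω) hx hk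
  simp only [smul_apply, ContinuousLinearMap.comp_apply, hstd,
    planarCovector_apply]
  simp [smul_smul, hk]

lemma hamiltonianStep [T2Space M] [IsManifold (𝓡 (m + 2)) ∞ M] [IsManifold (𝓡 m) ∞ N]
    (hZ : Disjoint φ.source (degeneracyLocus f k)) (hp : p ∈ φ.source) (hq : q ∈ φ.source)
    (hpq : f p = f q) : (jacobianPoisson μ Ω f k).HamiltonianStep p q := by
  set w := φ q - φ p with hw_def
  have hw : tailProj m w = 0 := by
    rw [hw_def, map_sub, ← hc.apply_eq q hq, ← hc.apply_eq p hp, hpq, sub_self]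
  have hk (x) (hx : x ∈ φ.source) : k x ≠ 0 := fun h => Set.disjoint_left.1 hZ hx (Or.inr h)
  set c : M → ℝ := fun x => (planarCoeff μ Ω f k φ x)⁻¹
  have hφ (x) (hx : x ∈ φ.source) := contMDiffAt_of_mem_maximalAtlas hc.mem_maximalAtlas hx
  have hcx (x) (hx : x ∈ φ.source) : ContMDiffAt (𝓡 (m + 2)) 𝓘(ℝ, ℝ) ∞ c x :=
    (contMDiffAt_planarCoeff hc.mem_maximalAtlas hx).inv₀ (hc.planarCoeff_ne_zero hx (hk x hx))
  let h : M → ℝ := fun x => c x * planarCovector w (φ x - φ p)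
  have hline (t : ℝ) (ht : t ∈ Set.Icc (0 : ℝ) 1) : φ p + t • w ∈ φ.target :=
    hc.convex_target.add_smul_sub_mem (φ.map_source hp) (φ.map_source hq) ht
  have hdh (t : ℝ) (ht : t ∈ Set.Icc (0 : ℝ) 1) :
      mvfderiv (𝓡 (m + 2)) h (φ.symm (φ p + t • w)) = c (φ.symm (φ p + t • w)) •
        (planarCovector w ∘L mvfderiv (𝓡 (m + 2)) φ (φ.symm (φ p + t • w))) := by
    have hx := φ.map_target (hline t ht)
    refine mvfderiv_mul_clm_sub _ ((hcx _ hx).mdifferentiableAt (by simp))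
      ((hφ _ hx).mdifferentiableAt (by simp)) ?_
    simp [φ.right_inv (hline t ht), planarCovector_apply, mul_comm]
  refine ⟨φ.source, h, fun x => jacobianAnchor μ Ω f k x (mvfderiv (𝓡 (m + 2)) h x),
    fun t => φ.symm (φ p + t • w), 0, 1, φ.open_source, fun x hx => ?_,
    fun x _ => jacobianPoisson_sharp_iff.2 rfl, zero_le_one, ?_, ?_,
    fun t ht => φ.map_target (hline t ht),
    isMIntegralCurveOn_symm_line hc.mem_maximalAtlas hline fun t ht => ?_⟩
  · exact ((hcx x hx).mul ((planarCovector w).contDiff.contMDiff.contMDiffAt.comp x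
      ((hφ x hx).sub contMDiffAt_const))).contMDiffWithinAt
  · simp [φ.left_inv hp]
  · simp [hw_def, φ.left_inv hq]
  · have hx := φ.map_target (hline t ht)
    rw [hdh t ht]
    exact hc.jacobianAnchor_planarCovector hx (hk _ hx) hw

lemma mem_charDist_iff [T2Space M] [IsManifold (𝓡 (m + 2)) ∞ M] [IsManifold (𝓡 m) ∞ N]
    (hx : x ∈ φ.source) (hk : k x ≠ 0) (v : TangentSpace (𝓡 (m + 2)) x) :
    v ∈ (jacobianPoisson μ Ω f k).charDist x ↔ tailProj m (mvfderiv (𝓡 (m + 2)) φ x v) = 0 := by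
  rw [charDist_jacobianPoisson, LinearMap.mem_range]
  constructor
  · rintro ⟨α, rfl⟩
    rw [← hc.mfderiv_eq_zero_iff hx (f.contMDiff.mdifferentiable (by simp) x)]
    exact mfderiv_jacobianAnchor α
  · intro hv
    rw [← coordField_mvfderiv hc.mem_maximalAtlas hx v]
    exact ⟨_, hc.jacobianAnchor_planarCovector hx hk hv⟩

end IsAdaptedChart

lemma charDist_jacobianPoisson_eq_bot [T2Space M] [IsManifold (𝓡 (m + 2)) ∞ M]
    [IsManifold (𝓡 m) ∞ N] (hx : x ∈ degeneracyLocus f k) :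
    (jacobianPoisson μ Ω f k).charDist x = ⊥ := by
  rw [charDist_jacobianPoisson, jacobianAnchor_eq_zero hx, LinearMap.range_zero]

end HamiltonianStep

section IntegralCurves

variable {E : Type*} [NormedAddCommGroup E] [NormedSpace ℝ E]
  {M : Type*} [TopologicalSpace M] [ChartedSpace E M]
  {F : Type*} [NormedAddCommGroup F] [NormedSpace ℝ F]
  {X : ∀ x : M, TangentSpace 𝓘(ℝ, E) x} {γ : ℝ → M} {s : Set ℝ} {a b t : ℝ}

lemma hasDerivWithinAt_comp_of_isMIntegralCurveOn (hγ : IsMIntegralCurveOn γ X s) (ht : t ∈ s)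
    {g : M → F} (hg : MDifferentiableAt 𝓘(ℝ, E) 𝓘(ℝ, F) g (γ t)) :
    HasDerivWithinAt (g ∘ γ) (mvfderiv 𝓘(ℝ, E) g (γ t) (X (γ t))) s t := by
  have hcomp : HasFDerivWithinAt (g ∘ γ) (_ : ℝ →L[ℝ] F) s t :=
    hasMFDerivWithinAt_iff_hasFDerivWithinAt.1
      (hg.hasMFDerivAt.comp_hasMFDerivWithinAt t (hγ t ht))
  refine hcomp.hasDerivWithinAt.congr_deriv ?_
  exact congrArg (mfderiv 𝓘(ℝ, E) 𝓘(ℝ, F) g (γ t)) (one_smul ℝ (X (γ t)))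

lemma isMIntegralCurveOn_zero_comp {N : Type*} [TopologicalSpace N] [ChartedSpace F N]
    {f : M → N} (hγ : IsMIntegralCurveOn γ X s)
    (hf : ∀ t ∈ s, MDifferentiableAt 𝓘(ℝ, E) 𝓘(ℝ, F) f (γ t))
    (hfX : ∀ t ∈ s, mfderiv 𝓘(ℝ, E) 𝓘(ℝ, F) f (γ t) (X (γ t)) = 0) :
    IsMIntegralCurveOn (f ∘ γ) (fun y => (0 : TangentSpace 𝓘(ℝ, F) y)) s := by
  intro t ht
  refine ((hf t ht).hasMFDerivAt.comp_hasMFDerivWithinAt t (hγ t ht)).congr_mfderiv ?_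
  refine ContinuousLinearMap.ext fun r : ℝ => ?_
  have hr := map_smul (mfderiv 𝓘(ℝ, E) 𝓘(ℝ, F) f (γ t)) r (X (γ t))
  rw [hfX t ht] at hr
  exact hr

variable {q : M} {φ : OpenPartialHomeomorph M E}

lemma eventually_eq_of_isMIntegralCurveOn_of_eq_zero
    (hφ : φ ∈ IsManifold.maximalAtlas 𝓘(ℝ, E) ∞ M) (hq : q ∈ φ.source)
    (hX : ContDiffAt ℝ 1 ((fun x => mvfderiv 𝓘(ℝ, E) φ x (X x)) ∘ φ.symm) (φ q)) (hXq : X q = 0)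
    (hγ : IsMIntegralCurveOn γ X (Set.Icc a b)) (ht : t ∈ Set.Ico a b) (hγt : γ t = q) :
    ∀ᶠ r in nhdsWithin t (Set.Ici t), γ r = q := by
  set Y := (fun x => mvfderiv 𝓘(ℝ, E) φ x (X x)) ∘ φ.symm with hY
  obtain ⟨K, u, hu, hYu⟩ := hX.exists_lipschitzOnWith
  have hcont : ContinuousWithinAt γ (Set.Ici t) t :=
    (hγ.continuousWithinAt (Set.Ico_subset_Icc_self ht)).mono_of_mem_nhdsWithin
      (Icc_mem_nhdsGE_of_mem ht)
  have hnhds : ∀ᶠ x in nhds (γ t), x ∈ φ.source ∧ φ x ∈ u := by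
    rw [hγt]
    exact (φ.open_source.eventually_mem hq).and ((φ.continuousAt hq).eventually hu)
  obtain ⟨c, htc, hc⟩ := mem_nhdsGE_iff_exists_Icc_subset.1
    ((hcont.eventually hnhds).and (Ico_mem_nhdsGE ht.2))
  have hab (r) (hr : r ∈ Set.Icc t c) : r ∈ Set.Ico a b := ⟨ht.1.trans hr.1, (hc hr).2.2⟩
  have hderiv (r) (hr : r ∈ Set.Icc t c) :
      HasDerivWithinAt (φ ∘ γ) (Y (φ (γ r))) (Set.Icc a b) r := by
    have hd := hasDerivWithinAt_comp_of_isMIntegralCurveOn hγ (Set.Ico_subset_Icc_self (hab r hr))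
      ((mdifferentiable_of_mem_maximalAtlas hφ).mdifferentiableAt (hc hr).1.1)
    rwa [hY, Function.comp_apply, φ.left_inv (hc hr).1.1]
  have hconst (r : ℝ) : HasDerivWithinAt (fun _ => φ q) (Y (φ q)) (Set.Ici r) r := by
    rw [hY, Function.comp_apply, φ.left_inv hq, hXq, map_zero]
    exact hasDerivWithinAt_const _ _ _
  have heq : Set.EqOn (φ ∘ γ) (fun _ => φ q) (Set.Icc t c) :=
    ODE_solution_unique_of_mem_Icc_right (v := fun _ => Y) (s := fun _ => u) (fun _ _ => hYu)
      (fun r hr => (hderiv r hr).continuousWithinAt.mono fun r' hr' =>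
        Set.Ico_subset_Icc_self (hab r' hr'))
      (fun r hr => (hderiv r (Set.Ico_subset_Icc_self hr)).mono_of_mem_nhdsWithin
        (Icc_mem_nhdsGE_of_mem (hab r (Set.Ico_subset_Icc_self hr))))
      (fun r hr => (hc (Set.Ico_subset_Icc_self hr)).1.2) continuousOn_const
      (fun r _ => hconst r) (fun _ _ => mem_of_mem_nhds hu) (congrArg φ hγt)
  filter_upwards [Icc_mem_nhdsGE htc] with r hr using φ.injOn (hc hr).1.1 hq (heq hr)

lemma eq_of_isMIntegralCurveOn_of_eq_zero [T1Space M]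
    (hφ : φ ∈ IsManifold.maximalAtlas 𝓘(ℝ, E) ∞ M) (hq : γ a ∈ φ.source)
    (hX : ContDiffAt ℝ 1 ((fun x => mvfderiv 𝓘(ℝ, E) φ x (X x)) ∘ φ.symm) (φ (γ a)))
    (hXa : X (γ a) = 0) (hγ : IsMIntegralCurveOn γ X (Set.Icc a b)) (ht : t ∈ Set.Icc a b) :
    γ t = γ a := by
  have hclosed : IsClosed (γ ⁻¹' {γ a} ∩ Set.Icc a b) := by
    rw [Set.inter_comm]
    exact hγ.continuousOn.preimage_isClosed_of_isClosed isClosed_Icc isClosed_singleton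
  refine hclosed.Icc_subset_of_forall_mem_nhdsWithin rfl (fun r hr => ?_) ht
  exact nhdsWithin_mono r Set.Ioi_subset_Ici_self
    (eventually_eq_of_isMIntegralCurveOn_of_eq_zero hφ hq hX hXa hγ hr.2 hr.1)

lemma map_eq_of_isMIntegralCurveOn {N : Type*} [TopologicalSpace N] [ChartedSpace F N]
    [IsManifold 𝓘(ℝ, F) ∞ N] {f : M → N} (hγ : IsMIntegralCurveOn γ X (Set.Icc a b))
    (hf : ∀ t ∈ Set.Icc a b, MDifferentiableAt 𝓘(ℝ, E) 𝓘(ℝ, F) f (γ t))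
    (hfX : ∀ t ∈ Set.Icc a b, mfderiv 𝓘(ℝ, E) 𝓘(ℝ, F) f (γ t) (X (γ t)) = 0)
    (ht : t ∈ Set.Icc a b) : f (γ t) = f (γ a) := by
  have : T1Space N := ChartedSpace.t1Space F N
  refine eq_of_isMIntegralCurveOn_of_eq_zero (IsManifold.chart_mem_maximalAtlas (f (γ a)))
    (mem_chart_source F _) ?_ rfl (isMIntegralCurveOn_zero_comp hγ hf hfX) ht
  simp only [map_zero]
  exact contDiffAt_const

end IntegralCurves

namespace PoissonBracket

variable {n : ℕ} {M : Type*} [TopologicalSpace M] [ChartedSpace (EuclideanSpace ℝ (Fin n)) M]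
  {P : PoissonBracket n M} {p q : M}

lemma Sharp.neg {α : TangentSpace (𝓡 n) q →L[ℝ] ℝ} {v : TangentSpace (𝓡 n) q}
    (h : P.Sharp q α v) : P.Sharp q (-α) (-v) := by
  obtain ⟨h, rfl, hv⟩ := h
  refine ⟨-h, mvfderiv_neg, fun g => ?_⟩
  rw [map_neg, map_neg, hv g]
  rfl

lemma HamiltonianStep.symm (hpq : P.HamiltonianStep p q) : P.HamiltonianStep q p := by
  obtain ⟨U, h, X, γ, a, b, hU, hh, hX, hab, rfl, rfl, hγU, hγ⟩ := hpq
  have hmem (t : ℝ) : t ∈ Set.Icc (-b) (-a) ↔ t * -1 ∈ Set.Icc a b := by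
    rw [mul_neg_one, Set.neg_mem_Icc_iff]
  refine ⟨U, -h, (-1 : ℝ) • X, γ ∘ (· * -1), -b, -a, hU, hh.neg, fun x hx => ?_,
    neg_le_neg hab, by simp, by simp, fun t ht => hγU _ ((hmem t).1 ht),
    (hγ.comp_mul (-1)).mono fun t ht => (hmem t).1 ht⟩
  rw [mvfderiv_neg, neg_one_smul]
  exact (hX x hx).neg

end PoissonBracket

section Trajectories

variable {m : ℕ} {M : Type*} [TopologicalSpace M]
  [ChartedSpace (EuclideanSpace ℝ (Fin (m + 2))) M]
  {N : Type*} [TopologicalSpace N] [ChartedSpace (EuclideanSpace ℝ (Fin m)) N]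
  [IsManifold (𝓡 (m + 2)) ∞ M] [IsManifold (𝓡 m) ∞ N]
  {μ : VolumeForm (m + 2) M} {Ω : VolumeForm m N}
  {f : C^∞⟮𝓡 (m + 2), M; 𝓡 m, N⟯} {k : C^∞⟮𝓡 (m + 2), M; ℝ⟯} {p q : M}

lemma contDiffAt_jacobianAnchor_mvfderiv {h : M → ℝ} {X : ∀ x : M, TangentSpace (𝓡 (m + 2)) x}
    {φ : OpenPartialHomeomorph M (EuclideanSpace ℝ (Fin (m + 2)))}
    (hφ : φ ∈ IsManifold.maximalAtlas (𝓡 (m + 2)) ∞ M) (hq : q ∈ φ.source)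
    (hh : ContMDiffAt (𝓡 (m + 2)) 𝓘(ℝ, ℝ) ∞ h q)
    (hX : ∀ᶠ x in nhds q, X x = jacobianAnchor μ Ω f k x (mvfderiv (𝓡 (m + 2)) h x)) :
    ContDiffAt ℝ ∞ ((fun x => mvfderiv (𝓡 (m + 2)) φ x (X x)) ∘ φ.symm) (φ q) := by
  rw [contDiffAt_euclidean]
  intro i
  refine contDiffAt_comp_symm hφ hq (g := fun x => mvfderiv (𝓡 (m + 2)) φ x (X x) i) ?_
  refine (contMDiffAt_jacobianBivector (μ := μ) (Ω := Ω) (f := f) (k := k)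
    (contMDiffAt_coordinate hφ hq i) hh).congr_of_eventuallyEq ?_
  filter_upwards [hX, φ.open_source.mem_nhds hq] with x hx hxφ
  rw [hx, ← apply_jacobianAnchor, mvfderiv_coordinate hφ hxφ]
  rfl

variable [T2Space M]

lemma eq_of_hamiltonianStep_of_mem_degeneracyLocus (hp : p ∈ degeneracyLocus f k)
    (hpq : (jacobianPoisson μ Ω f k).HamiltonianStep p q) : q = p := by
  obtain ⟨U, h, X, γ, a, b, hU, hh, hX, hab, rfl, rfl, hγU, hγ⟩ := hpq
  simp only [jacobianPoisson_sharp_iff] at hX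
  have haU : γ a ∈ U := hγU a (Set.left_mem_Icc.2 hab)
  refine eq_of_isMIntegralCurveOn_of_eq_zero (IsManifold.chart_mem_maximalAtlas (γ a))
    (mem_chart_source _ (γ a)) ?_ ?_ hγ (Set.right_mem_Icc.2 hab)
  · refine (contDiffAt_jacobianAnchor_mvfderiv (μ := μ) (Ω := Ω) (f := f) (k := k)
      (IsManifold.chart_mem_maximalAtlas (γ a)) (mem_chart_source _ (γ a))
      (hh.contMDiffAt (hU.mem_nhds haU)) ?_).of_le (by simp)
    filter_upwards [hU.mem_nhds haU] with x hx using hX x hx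
  · rw [hX _ haU, jacobianAnchor_eq_zero hp, LinearMap.zero_apply]

lemma mem_connectedComponentIn_of_hamiltonianStep (hp : p ∉ degeneracyLocus f k)
    (hpq : (jacobianPoisson μ Ω f k).HamiltonianStep p q) :
    q ∈ connectedComponentIn (f ⁻¹' {f p} \ degeneracyLocus f k) p := by
  obtain ⟨U, h, X, γ, a, b, hU, hh, hX, hab, rfl, rfl, hγU, hγ⟩ := hpq
  have hpre : IsPreconnected (γ '' Set.Icc a b) := isPreconnected_Icc.image γ hγ.continuousOn
  refine hpre.subset_connectedComponentIn ⟨a, Set.left_mem_Icc.2 hab, rfl⟩ ?_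
    ⟨b, Set.right_mem_Icc.2 hab, rfl⟩
  rintro _ ⟨t, ht, rfl⟩
  refine ⟨?_, fun hZ => hp ?_⟩
  · refine map_eq_of_isMIntegralCurveOn hγ
      (fun r _ => f.contMDiff.mdifferentiable (by simp) (γ r)) (fun r hr => ?_) ht
    rw [jacobianPoisson_sharp_iff.1 (hX _ (hγU r hr))]
    exact mfderiv_jacobianAnchor _
  · have hsub : Set.Icc a t ⊆ Set.Icc a b := Set.Icc_subset_Icc_right ht.2
    have hstep : (jacobianPoisson μ Ω f k).HamiltonianStep (γ a) (γ t) :=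
      ⟨U, h, X, γ, a, t, hU, hh, hX, ht.1, rfl, rfl, fun r hr => hγU r (hsub hr), hγ.mono hsub⟩
    rwa [eq_of_hamiltonianStep_of_mem_degeneracyLocus hZ hstep.symm]

end Trajectories

section Leaves

variable {m : ℕ} {M : Type*} [TopologicalSpace M] [T2Space M]
  [ChartedSpace (EuclideanSpace ℝ (Fin (m + 2))) M] [IsManifold (𝓡 (m + 2)) ∞ M]
  {N : Type*} [TopologicalSpace N] [ChartedSpace (EuclideanSpace ℝ (Fin m)) N]
  [IsManifold (𝓡 m) ∞ N]
  {μ : VolumeForm (m + 2) M} {Ω : VolumeForm m N}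
  {f : C^∞⟮𝓡 (m + 2), M; 𝓡 m, N⟯} {k : C^∞⟮𝓡 (m + 2), M; ℝ⟯} {q : M} {L : Set M}

lemma leaf_jacobianPoisson_of_mem (hq : q ∈ degeneracyLocus f k) :
    (jacobianPoisson μ Ω f k).leaf q = {q} := by
  refine Set.eq_singleton_iff_unique_mem.2 ⟨Relation.ReflTransGen.refl, fun p hp => ?_⟩
  induction hp with
  | refl => rfl
  | tail _ hstep ih =>
    subst ih
    exact eq_of_hamiltonianStep_of_mem_degeneracyLocus hq hstep

lemma leaf_jacobianPoisson_subset (hq : q ∉ degeneracyLocus f k) :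
    (jacobianPoisson μ Ω f k).leaf q ⊆
      connectedComponentIn (f ⁻¹' {f q} \ degeneracyLocus f k) q := by
  intro p hp
  induction hp with
  | refl => exact mem_connectedComponentIn ⟨rfl, hq⟩
  | tail _ hstep ih =>
    obtain ⟨hfp, hp⟩ := connectedComponentIn_subset _ _ ih
    have hmem := mem_connectedComponentIn_of_hamiltonianStep hp hstep
    rw [Set.mem_singleton_iff.1 hfp] at hmem
    rwa [connectedComponentIn_eq ih]

lemma connectedComponentIn_subset_leaf_jacobianPoisson (hq : q ∉ degeneracyLocus f k) :
    connectedComponentIn (f ⁻¹' {f q} \ degeneracyLocus f k) q ⊆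
      (jacobianPoisson μ Ω f k).leaf q := by
  have hqS : q ∈ f ⁻¹' {f q} \ degeneracyLocus f k := ⟨rfl, hq⟩
  refine fun p hp => isPreconnected_connectedComponentIn.induction₂'
    (Relation.ReflTransGen (jacobianPoisson μ Ω f k).HamiltonianStep)
    (fun x hx => ?_) (fun _ _ _ _ _ _ => .trans) (mem_connectedComponentIn hqS) hp
  have hxS := connectedComponentIn_subset _ _ hx
  obtain ⟨φ, ψ, hc, hxφ, hZ⟩ := exists_isAdaptedChart_of_notMem_degeneracyLocus hxS.2
  filter_upwards [self_mem_nhdsWithin, nhdsWithin_le_nhds (φ.open_source.mem_nhds hxφ)]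
    with y hy hyφ
  have hxy : f x = f y := hxS.1.trans (connectedComponentIn_subset _ _ hy).1.symm
  exact ⟨.single (hc.hamiltonianStep hZ hxφ hyφ hxy),
    .single (hc.hamiltonianStep hZ hyφ hxφ hxy.symm)⟩

lemma leaf_jacobianPoisson_of_notMem (hq : q ∉ degeneracyLocus f k) :
    (jacobianPoisson μ Ω f k).leaf q =
      connectedComponentIn (f ⁻¹' {f q} \ degeneracyLocus f k) q :=
  (leaf_jacobianPoisson_subset hq).antisymm (connectedComponentIn_subset_leaf_jacobianPoisson hq)

lemma PoissonBracket.IsIntegralSubmanifold.finrank_eq {n d : ℕ} {M : Type*} [TopologicalSpace M]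
    [ChartedSpace (EuclideanSpace ℝ (Fin n)) M]
    {D : ∀ x : M, Submodule ℝ (TangentSpace (𝓡 n) x)} {L : Set M}
    (hL : IsIntegralSubmanifold D d L) {p : M} (hp : p ∈ L) : Module.finrank ℝ (D p) = d := by
  obtain ⟨φ, hφ, hpφ, W, hW, hslice⟩ := hL p hp
  let e : TangentSpace (𝓡 n) p ≃ₗ[ℝ] EuclideanSpace ℝ (Fin n) :=
    ((mdifferentiable_of_mem_maximalAtlas hφ).mfderiv hpφ).toLinearEquiv
  have hD : D p = W.map e.symm.toLinearMap := by
    ext v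
    rw [Submodule.mem_map_equiv]
    exact (hslice p hpφ).2 hp v
  rw [hD, LinearEquiv.finrank_map_eq, hW]

lemma isIntegralSubmanifold_leaf_jacobianPoisson (hq : q ∉ degeneracyLocus f k) :
    PoissonBracket.IsIntegralSubmanifold (jacobianPoisson μ Ω f k).charDist 2
      ((jacobianPoisson μ Ω f k).leaf q) := by
  intro p hp
  have hS (x) (hx : x ∈ (jacobianPoisson μ Ω f k).leaf q) :
      x ∈ f ⁻¹' {f q} \ degeneracyLocus f k :=
    connectedComponentIn_subset _ _ (leaf_jacobianPoisson_subset hq hx)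
  obtain ⟨φ, ψ, hc, hpφ, hZ⟩ := exists_isAdaptedChart_of_notMem_degeneracyLocus (hS p hp).2
  refine ⟨φ, hc.mem_maximalAtlas, hpφ, LinearMap.ker (tailProj m).toLinearMap,
    finrank_ker_tailProj, fun x hx => ⟨?_, fun _ => hc.mem_charDist_iff hx fun hkx =>
      Set.disjoint_left.1 hZ hx (Or.inr hkx)⟩⟩
  have hslice : φ x - φ p ∈ LinearMap.ker (tailProj m).toLinearMap ↔ f x = f p := by
    rw [LinearMap.mem_ker, ContinuousLinearMap.coe_coe, map_sub, ← hc.apply_eq x hx,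
      ← hc.apply_eq p hpφ, sub_eq_zero]
    exact ψ.injOn.eq_iff (hc.mapsTo hx) (hc.mapsTo hpφ)
  rw [hslice]
  exact ⟨fun hxL => (hS x hxL).1.trans (hS p hp).1.symm,
    fun hxp => hp.tail (hc.hamiltonianStep hZ hpφ hx hxp.symm)⟩

lemma PoissonBracket.isIntegralSubmanifold_singleton {n : ℕ} {M : Type*} [TopologicalSpace M]
    [ChartedSpace (EuclideanSpace ℝ (Fin n)) M] [IsManifold (𝓡 n) ∞ M]
    {D : ∀ x : M, Submodule ℝ (TangentSpace (𝓡 n) x)} {q : M} (hq : D q = ⊥) :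
    IsIntegralSubmanifold D 0 {q} := by
  rintro p rfl
  set φ := chartAt (EuclideanSpace ℝ (Fin n)) p
  have hφ : φ ∈ IsManifold.maximalAtlas (𝓡 n) ∞ M := IsManifold.chart_mem_maximalAtlas p
  have hpφ : p ∈ φ.source := mem_chart_source _ p
  refine ⟨φ, hφ, hpφ, ⊥, finrank_bot _ _, fun x hx => ⟨?_, ?_⟩⟩
  · rw [Submodule.mem_bot, sub_eq_zero, Set.mem_singleton_iff]
    exact (φ.injOn.eq_iff hx hpφ).symm
  · rintro rfl v
    rw [hq, Submodule.mem_bot, Submodule.mem_bot]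
    exact ((mdifferentiable_of_mem_maximalAtlas hφ).mfderiv hx).map_eq_zero_iff.symm

lemma isSymplecticLeaf_leaf_two_iff :
    (jacobianPoisson μ Ω f k).IsSymplecticLeaf 2 ((jacobianPoisson μ Ω f k).leaf q) ↔
      q ∉ degeneracyLocus f k := by
  refine ⟨fun h hq => ?_, fun hq => ⟨⟨q, rfl⟩, isIntegralSubmanifold_leaf_jacobianPoisson hq⟩⟩
  have hrank := h.2.finrank_eq Relation.ReflTransGen.refl
  rw [charDist_jacobianPoisson_eq_bot hq, finrank_bot] at hrank
  exact two_ne_zero hrank.symm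

lemma isSymplecticLeaf_leaf_zero_iff :
    (jacobianPoisson μ Ω f k).IsSymplecticLeaf 0 ((jacobianPoisson μ Ω f k).leaf q) ↔
      q ∈ degeneracyLocus f k := by
  refine ⟨fun h => not_not.1 fun hq => ?_, fun hq => ⟨⟨q, rfl⟩, ?_⟩⟩
  · exact two_ne_zero (((isSymplecticLeaf_leaf_two_iff.2 hq).2.finrank_eq
      Relation.ReflTransGen.refl).symm.trans (h.2.finrank_eq Relation.ReflTransGen.refl))
  · rw [leaf_jacobianPoisson_of_mem hq]
    exact PoissonBracket.isIntegralSubmanifold_singleton (charDist_jacobianPoisson_eq_bot hq)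

lemma isSymplecticLeaf_two_iff :
    (jacobianPoisson μ Ω f k).IsSymplecticLeaf 2 L ↔
      ∃ s : N, IsComponentOf L (f ⁻¹' {s} \ degeneracyLocus f k) := by
  constructor
  · intro hL
    obtain ⟨q, rfl⟩ := hL.1
    have hq := isSymplecticLeaf_leaf_two_iff.1 hL
    exact ⟨f q, q, ⟨rfl, hq⟩, leaf_jacobianPoisson_of_notMem hq⟩
  · rintro ⟨_, q, ⟨rfl, hq⟩, rfl⟩
    rw [← leaf_jacobianPoisson_of_notMem (μ := μ) (Ω := Ω) hq]
    exact isSymplecticLeaf_leaf_two_iff.2 hq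

lemma isSymplecticLeaf_zero_iff :
    (jacobianPoisson μ Ω f k).IsSymplecticLeaf 0 L ↔ ∃ x ∈ degeneracyLocus f k, L = {x} := by
  constructor
  · intro hL
    obtain ⟨q, rfl⟩ := hL.1
    have hq := isSymplecticLeaf_leaf_zero_iff.1 hL
    exact ⟨q, hq, leaf_jacobianPoisson_of_mem hq⟩
  · rintro ⟨q, hq, rfl⟩
    rw [← leaf_jacobianPoisson_of_mem (μ := μ) (Ω := Ω) hq]
    exact isSymplecticLeaf_leaf_zero_iff.2 hq

end Leaves

section CriticalSet

variable {m : ℕ} {M : Type*} [TopologicalSpace M]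
  [ChartedSpace (EuclideanSpace ℝ (Fin (m + 2))) M]
  {N : Type*} [TopologicalSpace N] [ChartedSpace (EuclideanSpace ℝ (Fin m)) N]
  {f : C^∞⟮𝓡 (m + 2), M; 𝓡 m, N⟯} {k : C^∞⟮𝓡 (m + 2), M; ℝ⟯}

lemma degeneracyLocus_eq_criticalSet (hk : ∀ x, k x ≠ 0) : degeneracyLocus f k = criticalSet f := by
  simp [degeneracyLocus, hk]

lemma preimage_diff_criticalSet {s : N} (hs : ¬ IsSingularValue f s) :
    f ⁻¹' {s} \ criticalSet f = f ⁻¹' {s} :=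
  sdiff_eq_left.2 (Set.disjoint_left.2 fun x hx hxC => hs ⟨x, hxC, hx⟩)

lemma exists_isComponentOf_diff_criticalSet_iff {L : Set M} :
    (∃ s : N, IsComponentOf L (f ⁻¹' {s} \ criticalSet f)) ↔
      (∃ s : N, ¬ IsSingularValue f s ∧ IsComponentOf L (f ⁻¹' {s})) ∨
      (∃ s : N, IsSingularValue f s ∧ IsComponentOf L (f ⁻¹' {s} \ criticalSet f)) := by
  rw [← exists_or]
  refine exists_congr fun s => ?_
  by_cases hs : IsSingularValue f s
  · simp [hs]
  · simp [hs, preimage_diff_criticalSet hs]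

end CriticalSet

end

theorem theorem2_general {m : ℕ}
    {M : Type*} [TopologicalSpace M] [T2Space M]
    [ChartedSpace (EuclideanSpace ℝ (Fin (m + 2))) M] [IsManifold (𝓡 (m + 2)) ∞ M]
    {N : Type*} [TopologicalSpace N]
    [ChartedSpace (EuclideanSpace ℝ (Fin m)) N] [IsManifold (𝓡 m) ∞ N]
    (μ : VolumeForm (m + 2) M) (Ω : VolumeForm m N)
    (f : C^∞⟮𝓡 (m + 2), M; 𝓡 m, N⟯) (k : C^∞⟮𝓡 (m + 2), M; ℝ⟯) :
    (∃! br : C^∞⟮𝓡 (m + 2), M; ℝ⟯ → C^∞⟮𝓡 (m + 2), M; ℝ⟯ → C^∞⟮𝓡 (m + 2), M; ℝ⟯,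
      SatisfiesFormula μ Ω f k br) ∧
    ∃ P : PoissonBracket (m + 2) M, SatisfiesFormula μ Ω f k (fun g h => P.bracket g h) ∧
      (∀ q : M, P.IsSymplecticLeaf 2 (P.leaf q) ∨ P.IsSymplecticLeaf 0 (P.leaf q)) ∧
      (∀ L : Set M, P.IsSymplecticLeaf 2 L ↔
        ∃ s : N, IsComponentOf L (f ⁻¹' {s} \ degeneracyLocus f k)) ∧
      (∀ L : Set M, P.IsSymplecticLeaf 0 L ↔ ∃ x ∈ degeneracyLocus f k, L = {x}) := by
  refine ⟨?_, jacobianPoisson μ Ω f k, satisfiesFormula_iff_eq_jacobianBracket.2 rfl, fun q => ?_,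
    fun L => isSymplecticLeaf_two_iff, fun L => isSymplecticLeaf_zero_iff⟩
  · simp only [satisfiesFormula_iff_eq_jacobianBracket, existsUnique_eq]
  · rw [isSymplecticLeaf_leaf_two_iff, isSymplecticLeaf_leaf_zero_iff]
    exact (em _).symm

theorem theorem2 {m : ℕ}
    {M : Type*} [TopologicalSpace M] [T2Space M] [SecondCountableTopology M]
    [ChartedSpace (EuclideanSpace ℝ (Fin (m + 2))) M] [IsManifold (𝓡 (m + 2)) ∞ M]
    {N : Type*} [TopologicalSpace N] [T2Space N] [SecondCountableTopology N]
    [ChartedSpace (EuclideanSpace ℝ (Fin m)) N] [IsManifold (𝓡 m) ∞ N]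
    (μ : VolumeForm (m + 2) M) (Ω : VolumeForm m N)
    (f : C^∞⟮𝓡 (m + 2), M; 𝓡 m, N⟯)
    (k : C^∞⟮𝓡 (m + 2), M; ℝ⟯) (hk : ∀ x, k x ≠ 0) :
    -- the formula defines a unique bracket
    (∃! br : C^∞⟮𝓡 (m + 2), M; ℝ⟯ → C^∞⟮𝓡 (m + 2), M; ℝ⟯ → C^∞⟮𝓡 (m + 2), M; ℝ⟯,
      SatisfiesFormula μ Ω f k br) ∧
    -- it is a Poisson bracket
    ∃ P : PoissonBracket (m + 2) M, SatisfiesFormula μ Ω f k (fun g h => P.bracket g h) ∧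
      -- every symplectic leaf is a submanifold of dimension 2 or 0
      (∀ q : M, P.IsSymplecticLeaf 2 (P.leaf q) ∨ P.IsSymplecticLeaf 0 (P.leaf q)) ∧
      -- the 2-dimensional leaves: the components of the regular fibres, and of the singular
      -- fibres with the critical set removed
      (∀ L : Set M, P.IsSymplecticLeaf 2 L ↔
        (∃ s : N, ¬ IsSingularValue f s ∧ IsComponentOf L (f ⁻¹' {s})) ∨
        (∃ s : N, IsSingularValue f s ∧ IsComponentOf L (f ⁻¹' {s} \ criticalSet f))) ∧
      -- the 0-dimensional leaves: the points of the critical set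
      (∀ L : Set M, P.IsSymplecticLeaf 0 L ↔ ∃ x ∈ criticalSet f, L = {x}) := by
  simpa only [degeneracyLocus_eq_criticalSet hk, exists_isComponentOf_diff_criticalSet_iff]
    using theorem2_general μ Ω f k
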